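/- For $n\ge 0$ let $\mathbb Z^n_+$ be the set of generalized partitions of level $n$, i.e. integer sequences $\lambda=(\lambda_1\ge\cdots\ge\lambda_n)$, and put $\lambda^*=(-\lambda_n,\dots,-\lambda_1)$. The rational Schur polynomial $s_\lambda(x_1,\dots,x_n)\in\mathbb Z[x_1^{\pm1},\dots,x_n^{\pm1}]$ is the weight generating function of the rational $[n]$-semistandard tableaux of shape $\lambda$. These are the fillings of the generalized Young diagram of $\lambda$ (row $k$ has nodes in columns $1,\dots,\lambda_k$ if $\lambda_k\ge 0$, and in columns $\lambda_k,\dots,-1$ if $\lambda_k\le 0$) such that: entries in positive columns lie in $\{1,\dots,n\}$ and entries in negative columns in $\{-n,\dots,-1\}$; rows weakly increase from left to right and columns strictly increase from top to bottom; and if $b_1<\cdots<b_s$ are the entries of column $1$, $b'_1,\dots,b'_t$ the absolute values of the entries of column $-1$, and $b''_1<\cdots<b''_{n-t}$ the elements of $[n]\setminus\{b'_1,\dots,b'_t\}$, then $b''_i\le b_i$ for $1\le i\le s$. The exponent of $x_k$ in the weight is the number of entries $k$ minus the number of entries $-k$. Let $\mathscr R=\bigoplus_{n\ge0}\mathscr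 R_n$, where $\mathscr R_n$ is the free $\mathbb Z$-module on the $s_\lambda$, $\lambda\in\mathbb Z_+^n$ (so $\mathscr R_0=\mathbb Z$). Let $\Delta$ be the comultiplication whose components $\mathscr R_{p+q}\to\mathscr R_p\otimes\mathscr R_q$ are obtained by splitting the variables, $s_\lambda(x_1,\dots,x_{p+q})=\sum_{\mu\in\mathbb Z_+^p,\,\nu\in\mathbb Z_+^q}\hat c^{\lambda}_{\mu\nu}\,s_\mu(x_1,\dots,x_p)\,s_\nu(x_{p+1},\dots,x_{p+q})$ (a finite sum), and let $\varepsilon$ be the counit, which vanishes on $\mathscr R_n$ for $n\ge1$ and has $\varepsilon(1)=1$. Let $\mathscr R^*=\bigoplus_{n\ge0}\operatorname{Hom}_{\mathbb Z}(\mathscr R_n,\mathbb Z)$ be the graded dual with the multiplication dual to $\Delta$ and unit $\varepsilon$, and let $\sigma_\lambda\in\mathscr R^*$ be dual to $s_\lambda$. Then the rational Schur polynomials of each level $n$ are linearly independent over $\mathbb Z$, the comultiplication $\Delta$ exists and is unique, and $\mathscr R^*$ is a commutative associative $\mathbb Z$-algebra with unit $\varepsilon$. The $\mathbb Z$-linear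 map $\omega:\mathscr R^*\to\mathscr R^*$, $\omega\bigl(\sum_\lambda a_\lambda\sigma_\lambda\bigr)=\sum_\lambda a_\lambda\sigma_{\lambda^*}$ (on each $\operatorname{Hom}(\mathscr R_n,\mathbb Z)$ the sum over $\lambda\in\mathbb Z^n_+$ may be infinite), which fixes $\varepsilon$, is an involution of the $\mathbb Z$-algebra $\mathscr R^*$: $\omega(ab)=\omega(a)\omega(b)$ and $\omega(\omega(a))=a$ for all $a,b\in\mathscr R^*$. Moreover $\hat c^{\lambda}_{\mu\nu}=\hat c^{\lambda^*}_{\mu^*\nu^*}$ for all $p,q\ge 0$, $\lambda\in\mathbb Z_+^{p+q}$, $\mu\in\mathbb Z_+^p$ and $\nu\in\mathbb Z_+^q$. -/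

import Mathlib

open scoped TensorProduct DirectSum

noncomputable section

/-- Generalized partitions of level `n`: weakly decreasing sequences `l₁ ≥ ⋯ ≥ lₙ` of integers
(the row with label `k` is `l (k-1)`). -/
def GenPart (n : ℕ) : Type := {l : Fin n → ℤ // Antitone l}

namespace GenPart

/-- The dual generalized partition `l* = (-lₙ, …, -l₁)`. -/
def star {n : ℕ} (l : GenPart n) : GenPart n :=
  ⟨fun i => -l.1 i.rev, fun _ _ hij => neg_le_neg (l.2 (Fin.rev_le_rev.mpr hij))⟩

/-- The unique generalized partition of level `0`. -/
def empty : GenPart 0 := ⟨fun _ => 0, fun _ _ _ => le_rfl⟩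

/-- The nodes of the generalized Young diagram of `l`: in row `i` the columns `1, …, lᵢ` if
`lᵢ ≥ 0`, and the columns `lᵢ, …, -1` if `lᵢ ≤ 0`. -/
abbrev Node {n : ℕ} (l : GenPart n) : Type :=
  Σ i : Fin n, ↥(Finset.Icc (l.1 i) (-1) ∪ Finset.Icc 1 (l.1 i))

/-- The row of a node (numbered from `0`). -/
def Node.row {n : ℕ} {l : GenPart n} (c : l.Node) : Fin n := c.1

/-- The column of a node (a nonzero integer). -/
def Node.col {n : ℕ} {l : GenPart n} (c : l.Node) : ℤ := c.2.1

/-- Fillings of the diagram of `l` with integers between `-n` and `n`. -/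
abbrev Filling {n : ℕ} (l : GenPart n) : Type :=
  l.Node → ↥(Finset.Icc (-(n : ℤ)) (n : ℤ))

/-- The set `{b'₁, …, b'ₜ}` of the absolute values of the entries in column `-1`. -/
def Filling.negColumn {n : ℕ} {l : GenPart n} (T : l.Filling) : Finset ℕ :=
  (Finset.univ.filter fun c : l.Node => c.col = -1).image fun c => (T c).1.natAbs

/-- Rational `[n]`-semistandard tableaux of shape `l`. -/
structure Filling.IsRational {n : ℕ} {l : GenPart n} (T : l.Filling) : Prop where
  /-- entries in positive columns lie in `{1, …, n}` -/
  pos : ∀ c : l.Node, 0 < c.col → 1 ≤ (T c).1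
  /-- entries in negative columns lie in `{-n, …, -1}` -/
  neg : ∀ c : l.Node, c.col < 0 → (T c).1 ≤ -1
  /-- rows are weakly increasing -/
  row_weak : ∀ c d : l.Node, c.row = d.row → c.col ≤ d.col → (T c).1 ≤ (T d).1
  /-- columns are strictly increasing -/
  col_strict : ∀ c d : l.Node, c.col = d.col → c.row < d.row → (T c).1 < (T d).1
  /-- `b''ᵢ ≤ bᵢ` for every entry `bᵢ` of column `1`, where `b''₁ < b''₂ < ⋯` are the elements of
  `{1, …, n} ∖ {b'₁, …, b'ₜ}` (the nodes of column `1` occupy the topmost rows, so `bᵢ` stands in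
  the `i`-th row) -/
  first_col : ∀ c : l.Node, c.col = 1 →
    ((Nat.nth (fun k => k ∈ Finset.Icc 1 n \ T.negColumn) (c.row : ℕ) : ℕ) : ℤ) ≤ (T c).1

/-- The weight of a filling: the exponent of `x_k` is `m_k - m_{-k}`, where `m_k` is the number of
occurrences of `k`; the variable `x_k` has index `k - 1` in `Fin n`. -/
def Filling.weight {n : ℕ} {l : GenPart n} (T : l.Filling) : Fin n → ℤ := fun k =>
  ((Finset.univ.filter fun c : l.Node => (T c).1 = (k : ℤ) + 1).card : ℤ) -
    ((Finset.univ.filter fun c : l.Node => (T c).1 = -((k : ℤ) + 1)).card : ℤ)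

end GenPart

/-- Laurent polynomials over `ℤ` in `n` variables; a monomial is its exponent vector. -/
abbrev LaurentPoly (n : ℕ) : Type := AddMonoidAlgebra ℤ (Fin n → ℤ)

instance (n : ℕ) : Module ℤ (LaurentPoly n) := AddMonoidAlgebra.instModule

open Classical in
/-- The rational Schur polynomial `s_l(x₁, …, xₙ)`. -/
def rationalSchur {n : ℕ} (l : GenPart n) : LaurentPoly n :=
  ∑ T ∈ Finset.univ.filter (fun T : l.Filling => T.IsRational),
    AddMonoidAlgebra.single T.weight 1

/-- `R_n`: the Grothendieck group of rational representations of `gl_n`, that is, the free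
`ℤ`-module on the `s_l`, `l` a generalized partition of level `n`. -/
abbrev RatRep (n : ℕ) : Type := GenPart n →₀ ℤ

instance (n : ℕ) : Module ℤ (RatRep n) := Finsupp.module _ _

instance (p q : ℕ) : Module ℤ (RatRep p ⊗[ℤ] RatRep q) := TensorProduct.instModule

/-- The basis element `s_l` of `R_n`. -/
def schurBasis {n : ℕ} (l : GenPart n) : RatRep n := Finsupp.single l 1

/-- The realization of `R_n` by Laurent polynomials, sending `s_l` to the rational Schur
polynomial. -/
def character (n : ℕ) : RatRep n →ₗ[ℤ] LaurentPoly n :=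
  Finsupp.linearCombination ℤ rationalSchur

/-- `f ↦ f(x₁, …, x_p)`, as a Laurent polynomial in the variables `x₁, …, x_{p+q}`. -/
def firstVars (p q : ℕ) : LaurentPoly p →ₗ[ℤ] LaurentPoly (p + q) :=
  AddMonoidAlgebra.mapDomainLinearMap ℤ ℤ fun v => Fin.append v (0 : Fin q → ℤ)

/-- `g ↦ g(x_{p+1}, …, x_{p+q})`, as a Laurent polynomial in the variables `x₁, …, x_{p+q}`. -/
def lastVars (p q : ℕ) : LaurentPoly q →ₗ[ℤ] LaurentPoly (p + q) :=
  AddMonoidAlgebra.mapDomainLinearMap ℤ ℤ fun v => Fin.append (0 : Fin p → ℤ) v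

/-- The realization of `R_p ⊗ R_q` by Laurent polynomials in two sets of variables,
`s_m ⊗ s_k ↦ s_m(x₁, …, x_p) s_k(x_{p+1}, …, x_{p+q})`. -/
def character₂ (p q : ℕ) : RatRep p ⊗[ℤ] RatRep q →ₗ[ℤ] LaurentPoly (p + q) :=
  TensorProduct.lift ((LinearMap.mul ℤ (LaurentPoly (p + q))).compl₁₂
    (firstVars p q ∘ₗ character p) (lastVars p q ∘ₗ character q))

/-- The component `R_{p+q} → R_p ⊗ R_q` of the comultiplication `Δ`: the linear map that rewrites
`s_l(x₁, …, x_{p+q})` in terms of the products `s_m(x₁, …, x_p) s_k(x_{p+1}, …, x_{p+q})`.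
Existence and uniqueness of this map are part of the main theorem. -/
def comul (p q : ℕ) : RatRep (p + q) →ₗ[ℤ] RatRep p ⊗[ℤ] RatRep q :=
  Classical.epsilon fun D => character₂ p q ∘ₗ D = character (p + q)

/-- The coefficient of `s_m ⊗ s_k` in `Δ(s_l)`. -/
def cHat {p q : ℕ} (l : GenPart (p + q)) (m : GenPart p) (k : GenPart q) : ℤ :=
  finsuppTensorFinsupp' ℤ (GenPart p) (GenPart q) (comul p q (schurBasis l)) (m, k)

/-- `R*_n = Hom(R_n, ℤ)`. -/
abbrev DualRep (n : ℕ) : Type := RatRep n →ₗ[ℤ] ℤ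

instance (n : ℕ) : Module ℤ (DualRep n) := LinearMap.module

/-- The product `R*_p × R*_q → R*_{p+q}` dual to `Δ`. -/
def dualMul {p q : ℕ} (φ : DualRep p) (ψ : DualRep q) : DualRep (p + q) :=
  LinearMap.mul' ℤ ℤ ∘ₗ TensorProduct.map φ ψ ∘ₗ comul p q

instance : DirectSum.GNonUnitalNonAssocSemiring DualRep where
  mul φ ψ := dualMul φ ψ
  mul_zero φ := by
    refine LinearMap.ext fun f => ?_
    simp [dualMul]
  zero_mul ψ := by
    refine LinearMap.ext fun f => ?_
    simp [dualMul]
  mul_add φ ψ χ := by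
    refine LinearMap.ext fun f => ?_
    simp [dualMul, TensorProduct.map_add_right]
  add_mul φ ψ χ := by
    refine LinearMap.ext fun f => ?_
    simp [dualMul, TensorProduct.map_add_left]

/-- The graded dual `R* = ⨁ₙ R*_n`, with the multiplication `Δ*` given on homogeneous elements
by `dualMul`. -/
abbrev DualRing : Type := ⨁ n, DualRep n

instance : Module ℤ DualRing := DirectSum.instModule

/-- `σ_l`, the element of `R*` dual to `s_l`. -/
def sigma {n : ℕ} (l : GenPart n) : DualRing :=
  DirectSum.of DualRep n (Finsupp.lapply l)

/-- The counit `ε` of `R`: it vanishes on `R_n` for `n ≥ 1`, and `ε(1) = 1` for the unity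
`1 = s_∅` of `R_0 = ℤ`. -/
def counit : DualRing :=
  DirectSum.of DualRep 0 (Finsupp.lapply GenPart.empty)

/-- `s_l ↦ s_{l*}` on `R_n`. -/
def starMap (n : ℕ) : RatRep n →ₗ[ℤ] RatRep n :=
  Finsupp.lmapDomain ℤ ℤ GenPart.star

/-- The `ℤ`-linear map `ω : R* → R*`, which on `R*_n` sends the (possibly infinite) combination
`φ = ∑ a_l σ_l`, where `a_l = φ(s_l)`, to `∑ a_l σ_{l*}`, that is, to `s_l ↦ φ(s_{l*})`. -/
def omega : DualRing →ₗ[ℤ] DualRing :=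
  DirectSum.lmap fun n => LinearMap.lcomp ℤ ℤ (starMap n)

end

/-! The heart of the matter is that `s_{l*}` is `s_l` with all variables inverted, and that
inverting variables commutes with splitting them into two sets. This is made visible by replacing
tableaux with Gelfand–Tsetlin patterns. Deleting the entries `n + 1` and `-(n + 1)` from a rational
tableau of level `n + 1` leaves a rational tableau of level `n` whose shape interlaces the old one,
and this is reversible; so the coefficients of `s_l` are the numbers `gtCount`
(`GenPart.rationalSchur_coeff`).

On patterns three facts are accessible. Negating and reversing every row inverts the variables
(`gtCount_neg_rev`). Reflecting one row between its neighbours, as in the Bender–Knuth involution,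
shows that `s_l` is symmetric (`gtCount_perm`). The weights of patterns lie below the top row, which
itself occurs once (`gtCount_support`, `gtCount_self`). By the last fact, reading off coefficients
at dominant exponents is bijective on `R_n`, whence linear independence. The same holds on `R_p ⊗
R_q`; together with symmetry in each block of variables this gives the existence and uniqueness of
`Δ` (`exists_character₂_eq`, `character₂_injective`).

For the dual algebra, every functional on `R_n` sends `f` to the sum of its coefficients weighted by
some function `F` of the exponent (`dualOfFun_surjective`). The product then multiplies functions in
separate blocks of variables (`dualMul_dualOfFun`), and `ω` becomes `F(w) ↦ F(-w)`. Associativity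
and multiplicativity of `ω` are now evident, and commutativity follows since `F` matters only up to
permuting the variables (`dualOfFun_perm`). -/

/-! ### Gelfand–Tsetlin patterns -/

/-- The integer vectors of length `n` that interlace a given vector of length `n + 1`. -/
noncomputable def interlacing {n : ℕ} (l : Fin (n + 1) → ℤ) : Finset (Fin n → ℤ) :=
  Fintype.piFinset fun i => Finset.Icc (l i.succ) (l i.castSucc)

lemma mem_interlacing {n : ℕ} {l : Fin (n + 1) → ℤ} {m : Fin n → ℤ} :
    m ∈ interlacing l ↔ ∀ i, l i.succ ≤ m i ∧ m i ≤ l i.castSucc := by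
  simp [interlacing]

/-- The number of Gelfand–Tsetlin patterns with top row `l` and weight `w`. -/
noncomputable def gtCount : (n : ℕ) → (Fin n → ℤ) → (Fin n → ℤ) → ℤ
  | 0, _, _ => 1
  | n + 1, l, w => ∑ m ∈ interlacing l,
      if ∑ i, l i - ∑ i, m i = w (Fin.last n) then gtCount n m (Fin.init w) else 0

/-- Negating and reversing each row of a pattern preserves interlacing and negates all differences
of row sums. -/
lemma gtCount_neg_rev (n : ℕ) (l w : Fin n → ℤ) :
    gtCount n (fun i => -l i.rev) (fun i => -w i) = gtCount n l w := by
  induction n with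
  | zero => rfl
  | succ n ih =>
    have hsum : ∀ (k : ℕ) (v : Fin k → ℤ), ∑ i, -v (Fin.rev i) = -∑ i, v i := by
      intro k v
      rw [Finset.sum_neg_distrib, ← Equiv.sum_comp Fin.revPerm v]
      rfl
    have hmem : ∀ (l : Fin (n + 1) → ℤ) (m : Fin n → ℤ), m ∈ interlacing l →
        (fun i => -m (Fin.rev i)) ∈ interlacing (fun i => -l (Fin.rev i)) := by
      intro l m hm
      rw [mem_interlacing] at hm ⊢
      intro i
      have := hm i.rev
      rw [Fin.rev_succ, Fin.rev_castSucc]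
      constructor <;> linarith [this.1, this.2]
    unfold gtCount
    refine Finset.sum_bij' (fun m _ i => -m (Fin.rev i)) (fun m _ i => -m (Fin.rev i))
      (fun m hm => by simpa using hmem _ m hm) (fun m hm => hmem _ m hm)
      (fun m _ => by simp) (fun m _ => by simp) (fun m _ => ?_)
    rw [hsum, hsum]
    have h1 : (-∑ i, l i - ∑ i, m i = -w (Fin.last n)) ↔
        (∑ i, l i - -∑ i, m i = w (Fin.last n)) := by
      constructor <;> intro h <;> linarith
    simp only [h1]
    split_ifs
    · rw [← ih m]
      congr 1
      funext i
      simp [Fin.init]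
    · rfl

/-- This is the part of "weights are dominated by the top row" that unitriangularity needs. In the
induction, the excess of `∑ i * w i` over `∑ i * l i` is the corresponding excess for the next row
`m` plus the sum of `(n - i) * (l i - m i)`, and both are nonnegative. -/
lemma gtCount_support (n : ℕ) (l w : Fin n → ℤ) (h : gtCount n l w ≠ 0) :
    ∑ i, w i = ∑ i, l i ∧ (w = l ∨ ∑ i : Fin n, (i : ℤ) * l i < ∑ i : Fin n, (i : ℤ) * w i) := by
  induction n with
  | zero => exact ⟨by simp, Or.inl (Subsingleton.elim _ _)⟩
  | succ n ih =>
    unfold gtCount at h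
    obtain ⟨m, hm, hne⟩ := Finset.exists_ne_zero_of_sum_ne_zero h
    rw [mem_interlacing] at hm
    split_ifs at hne with hw
    · obtain ⟨h1, h2⟩ := ih _ _ hne
      simp only [Fin.init] at h1
      have hsum : ∑ i, w i = ∑ i, l i := by
        rw [Fin.sum_univ_castSucc, h1, ← hw]; ring
      refine ⟨hsum, ?_⟩
      have key : ∑ i : Fin n, ((n : ℤ) - i) * (l i.castSucc - m i) =
          n * (∑ i, l i - ∑ i, m i) + ∑ i : Fin n, (i : ℤ) * m i -
            ∑ i : Fin (n + 1), (i : ℤ) * l i := by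
        rw [Fin.sum_univ_castSucc l, Fin.sum_univ_castSucc (fun i : Fin (n + 1) => (i : ℤ) * l i)]
        simp only [Fin.val_castSucc, Fin.val_last, mul_add, mul_sub, Finset.mul_sum]
        simp only [sub_mul, Finset.sum_sub_distrib]
        ring
      have hnn : ∀ i ∈ (Finset.univ : Finset (Fin n)),
          0 ≤ ((n : ℤ) - i) * (l i.castSucc - m i) := by
        intro i _
        have := i.2
        exact mul_nonneg (by omega) (by linarith [(hm i).2])
      have hw' : ∑ i : Fin (n + 1), (i : ℤ) * w i =
          ∑ i : Fin n, (i : ℤ) * Fin.init w i + n * (∑ i, l i - ∑ i, m i) := by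
        rw [Fin.sum_univ_castSucc, hw]
        simp [Fin.init]
      rcases h2 with h2 | h2
      · rcases (Finset.sum_nonneg hnn).eq_or_lt with h0 | h0
        · left
          have hz := (Finset.sum_eq_zero_iff_of_nonneg hnn).1 h0.symm
          have hml : ∀ i, m i = l i.castSucc := by
            intro i
            have h3 := hz i (Finset.mem_univ i)
            have := i.2
            rcases mul_eq_zero.1 h3 with h4 | h4
            · omega
            · linarith
          have hinit : ∀ i : Fin n, w i.castSucc = l i.castSucc := fun i => by
            rw [← hml, ← h2]; rfl
          funext i
          refine Fin.lastCases ?_ hinit i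
          rw [← hw, Fin.sum_univ_castSucc, Finset.sum_congr rfl fun i _ => hml i]
          ring
        · right
          rw [h2] at hw'
          linarith
      · right
        have := Finset.sum_nonneg hnn
        linarith
    · exact absurd rfl hne

/-- In the only pattern of this weight, each row truncates the row above it: `m` is bounded by the
truncation entrywise and has the same sum. -/
lemma gtCount_self (n : ℕ) (l : Fin n → ℤ) (hl : Antitone l) : gtCount n l l = 1 := by
  induction n with
  | zero => rfl
  | succ n ih =>
    unfold gtCount
    rw [Finset.sum_eq_single (Fin.init l)]
    · rw [if_pos, ih]
      · intro i j hij
        exact hl (Fin.castSucc_le_castSucc_iff.2 hij)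
      · rw [Fin.sum_univ_castSucc]
        simp [Fin.init]
    · intro m hm hne
      rw [mem_interlacing] at hm
      split_ifs with hw
      · by_contra h0
        have h1 := (gtCount_support _ _ _ h0).1
        apply hne
        funext i
        have hle : ∀ i ∈ (Finset.univ : Finset (Fin n)), m i ≤ Fin.init l i := fun i _ => (hm i).2
        exact (Finset.sum_eq_sum_iff_of_le hle).1 h1.symm i (Finset.mem_univ i)
      · rfl
    · intro h
      refine absurd ?_ h
      rw [mem_interlacing]
      exact fun i => ⟨hl i.castSucc_lt_succ.le, le_rfl⟩

/-- Reflecting the middle row between two fixed rows exchanges the two steps. -/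
lemma sum_interlacing_swap (n : ℕ) (l : Fin (n + 2) → ℤ) (a b : ℤ) (f : (Fin n → ℤ) → ℤ) :
    (∑ m ∈ interlacing l, if ∑ i, l i - ∑ i, m i = a then
      ∑ v ∈ interlacing m, if ∑ i, m i - ∑ i, v i = b then f v else 0 else 0) =
    ∑ m ∈ interlacing l, if ∑ i, l i - ∑ i, m i = b then
      ∑ v ∈ interlacing m, if ∑ i, m i - ∑ i, v i = a then f v else 0 else 0 := by
  have hexp : ∀ a b : ℤ, (∑ m ∈ interlacing l, if ∑ i, l i - ∑ i, m i = a then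
      ∑ v ∈ interlacing m, if ∑ i, m i - ∑ i, v i = b then f v else 0 else 0) =
      ∑ x ∈ (interlacing l).sigma fun m => interlacing m,
        if ∑ i, l i - ∑ i, x.1 i = a ∧ ∑ i, x.1 i - ∑ i, x.2 i = b then f x.2 else 0 := by
    intro a b
    rw [Finset.sum_sigma]
    refine Finset.sum_congr rfl fun m _ => ?_
    split_ifs with h <;> simp [h]
  rw [hexp, hexp]
  -- For fixed outer rows `l` and `v`, the admissible middle rows fill a box with corners `lo v` and
  -- `hi v`, and the reflection is `m ↦ lo v + hi v - m`. Apart from the two end entries of `l`, the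
  -- corners are the max and the min of the same pairs, so their total is the sum of `l` and `v`;
  -- this is why the two steps are exchanged.
  let lo : (Fin n → ℤ) → Fin (n + 1) → ℤ := fun v =>
    Fin.snoc (fun i : Fin n => max (l i.castSucc.succ) (v i)) (l (Fin.last n).succ)
  let hi : (Fin n → ℤ) → Fin (n + 1) → ℤ := fun v =>
    Fin.cons (l (Fin.castSucc 0)) (fun i : Fin n => min (l i.succ.castSucc) (v i))
  have hmem : ∀ m v, (m ∈ interlacing l ∧ v ∈ interlacing m) ↔
      ∀ i, lo v i ≤ m i ∧ m i ≤ hi v i := by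
    intro m v
    rw [mem_interlacing, mem_interlacing, forall_and, forall_and, forall_and,
      Fin.forall_fin_succ' (P := fun i => l (Fin.succ i) ≤ m i),
      Fin.forall_fin_succ (P := fun i => m i ≤ l (Fin.castSucc i)),
      Fin.forall_fin_succ' (P := fun i => lo v i ≤ m i),
      Fin.forall_fin_succ (P := fun i => m i ≤ hi v i)]
    simp only [lo, hi, Fin.snoc_castSucc, Fin.snoc_last, Fin.cons_zero, Fin.cons_succ, max_le_iff,
      le_min_iff, forall_and]
    tauto
  have hsum : ∀ v : Fin n → ℤ, ∑ i, (lo v i + hi v i) = ∑ i, l i + ∑ i, v i := by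
    intro v
    rw [Finset.sum_add_distrib, Fin.sum_univ_castSucc (lo v), Fin.sum_univ_succ (hi v),
      Fin.sum_univ_succ l, Fin.sum_univ_castSucc (fun i : Fin (n + 1) => l i.succ)]
    simp only [lo, hi, Fin.snoc_castSucc, Fin.snoc_last, Fin.cons_zero, Fin.cons_succ]
    have : ∑ i : Fin n, max (l i.castSucc.succ) (v i) + ∑ i : Fin n, min (l i.succ.castSucc) (v i)
        = ∑ i : Fin n, l i.castSucc.succ + ∑ i, v i := by
      rw [← Finset.sum_add_distrib, ← Finset.sum_add_distrib]
      refine Finset.sum_congr rfl fun i _ => ?_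
      rw [add_comm, Fin.succ_castSucc]
      exact min_add_max _ _
    simp only [Fin.castSucc_zero]
    linarith
  have hmap : ∀ x ∈ (interlacing l).sigma fun m => interlacing m,
      (⟨fun i => lo x.2 i + hi x.2 i - x.1 i, x.2⟩ : Σ _ : Fin (n + 1) → ℤ, Fin n → ℤ) ∈
        (interlacing l).sigma fun m => interlacing m := by
    intro x hx
    rw [Finset.mem_sigma, hmem] at hx ⊢
    intro i
    have := hx i
    constructor <;> dsimp only <;> linarith [this.1, this.2]
  refine Finset.sum_bij' (fun x _ => ⟨fun i => lo x.2 i + hi x.2 i - x.1 i, x.2⟩)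
    (fun x _ => ⟨fun i => lo x.2 i + hi x.2 i - x.1 i, x.2⟩) hmap hmap
    (fun x _ => by simp) (fun x _ => by simp) (fun x _ => ?_)
  dsimp only
  rw [Finset.sum_sub_distrib, hsum]
  congr 1
  apply propext
  constructor <;> rintro ⟨h1, h2⟩ <;> constructor <;> linarith

/-- Exchanging the last two variables is the reflection of the second row; any other adjacent
transposition already acts on the pattern below the top row. -/
lemma gtCount_swap (n : ℕ) (l w : Fin (n + 1) → ℤ) (i : Fin n) :
    gtCount (n + 1) l (w ∘ Equiv.swap i.castSucc i.succ) = gtCount (n + 1) l w := by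
  induction n with
  | zero => exact i.elim0
  | succ n ih =>
    refine Fin.lastCases ?_ (fun i => ?_) i
    · have h1 : ∀ w : Fin (n + 2) → ℤ, gtCount (n + 2) l w =
          ∑ m ∈ interlacing l, if ∑ i, l i - ∑ i, m i = w (Fin.last (n + 1)) then
            ∑ v ∈ interlacing m, if ∑ i, m i - ∑ i, v i = w (Fin.last n).castSucc then
              gtCount n v (fun i => w i.castSucc.castSucc) else 0 else 0 := fun w => rfl
      rw [h1, h1, sum_interlacing_swap]
      have h2 : (fun i : Fin n => (w ∘ Equiv.swap (Fin.last n).castSucc (Fin.last n).succ)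
          i.castSucc.castSucc) = fun i => w i.castSucc.castSucc := by
        funext i
        rw [Function.comp_apply, Equiv.swap_apply_of_ne_of_ne]
        · intro h
          have := congrArg Fin.val h
          have := i.2
          simp only [Fin.val_castSucc, Fin.val_last] at *
          omega
        · intro h
          have := congrArg Fin.val h
          have := i.2
          simp only [Fin.val_castSucc, Fin.val_last, Fin.val_succ] at *
          omega
      rw [h2]
      simp only [Function.comp_apply, Equiv.swap_apply_left, ← Fin.succ_last,
        Equiv.swap_apply_right]
    · rw [gtCount, gtCount]
      refine Finset.sum_congr rfl fun m _ => ?_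
      have h1 : (w ∘ Equiv.swap i.castSucc.castSucc i.castSucc.succ) (Fin.last (n + 1)) =
          w (Fin.last (n + 1)) := by
        rw [Function.comp_apply, Equiv.swap_apply_of_ne_of_ne]
        · exact (Fin.castSucc_lt_last _).ne'
        · rw [← Fin.succ_last]
          exact fun h => (Fin.castSucc_lt_last i).ne' (Fin.succ_injective _ h)
      have h2 : Fin.init (w ∘ Equiv.swap i.castSucc.castSucc i.castSucc.succ) =
          Fin.init w ∘ Equiv.swap i.castSucc i.succ := by
        funext j
        simp only [Fin.init, Function.comp_apply, Equiv.swap_apply_def, Fin.succ_castSucc,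
          Fin.castSucc_inj]
        split_ifs <;> rfl
      rw [h1, h2, ih]

lemma gtCount_perm (n : ℕ) (l w : Fin n → ℤ) (s : Equiv.Perm (Fin n)) :
    gtCount n l (w ∘ s) = gtCount n l w := by
  cases n with
  | zero => rfl
  | succ n =>
    have hs : s ∈ Submonoid.closure
        (Set.range fun i : Fin n => Equiv.swap i.castSucc i.succ) := by
      rw [Equiv.Perm.mclosure_swap_castSucc_succ]; trivial
    induction hs using Submonoid.closure_induction generalizing w with
    | mem x hx =>
      obtain ⟨i, rfl⟩ := hx
      exact gtCount_swap n l w i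
    | one => rfl
    | mul x y _ _ hx hy =>
      rw [Equiv.Perm.coe_mul, ← Function.comp_assoc, hy, hx]

/-! ### Rational tableaux: the first-column condition, bounds on entries, total weight -/

namespace GenPart

namespace Node

variable {n : ℕ} {l : GenPart n}

lemma ext' {c d : l.Node} (h1 : c.row = d.row) (h2 : c.col = d.col) : c = d := by
  obtain ⟨i, j, hj⟩ := c
  obtain ⟨i', j', hj'⟩ := d
  simp only [row, col] at h1 h2
  subst h1 h2
  rfl

lemma spec (c : l.Node) :
    l.1 c.row ≤ c.col ∧ c.col ≤ -1 ∨ 1 ≤ c.col ∧ c.col ≤ l.1 c.row := by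
  have := c.2.2
  rwa [Finset.mem_union, Finset.mem_Icc, Finset.mem_Icc] at this

/-- The node in a given row and column. -/
def of (i : Fin n) (j : ℤ) (h : l.1 i ≤ j ∧ j ≤ -1 ∨ 1 ≤ j ∧ j ≤ l.1 i) : l.Node :=
  ⟨i, j, by rwa [Finset.mem_union, Finset.mem_Icc, Finset.mem_Icc]⟩

@[simp] lemma row_of (i : Fin n) (j : ℤ) (h) : (of i j h : l.Node).row = i := rfl

@[simp] lemma col_of (i : Fin n) (j : ℤ) (h) : (of i j h : l.Node).col = j := rfl

lemma le_of_pos {c : l.Node} (h : 0 < c.col) : c.col ≤ l.1 c.row := by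
  rcases c.spec with h' | h' <;> omega

lemma le_of_neg {c : l.Node} (h : c.col < 0) : l.1 c.row ≤ c.col := by
  rcases c.spec with h' | h' <;> omega

lemma neg_or_pos (c : l.Node) : c.col < 0 ∨ 0 < c.col := by
  rcases c.spec with h | h <;> omega

lemma pos_of_row_eq {c d : l.Node} (h : c.row = d.row) (hc : 0 < c.col) : 0 < d.col := by
  have h1 := le_of_pos hc
  rcases d.spec with h' | h'
  · rw [h] at h1; omega
  · omega

end Node

namespace Filling

variable {n : ℕ} {l : GenPart n} {T : l.Filling}

lemma le_level (T : l.Filling) (c : l.Node) : (T c).1 ≤ n := (Finset.mem_Icc.1 (T c).2).2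

lemma neg_level_le (T : l.Filling) (c : l.Node) : -(n : ℤ) ≤ (T c).1 :=
  (Finset.mem_Icc.1 (T c).2).1

lemma mem_negColumn {k : ℕ} :
    k ∈ T.negColumn ↔ ∃ c : l.Node, c.col = -1 ∧ (T c).1.natAbs = k := by
  simp [negColumn]

/-- A row cannot lie weakly above a row that meets column `1` and also meet column `-1`, so the
nodes of column `-1` fit in the rows strictly below `c`. -/
lemma card_negColumn_add_lt (T : l.Filling) (c : l.Node) (hc : c.col = 1) :
    T.negColumn.card + c.row < n := by
  have h1 : T.negColumn.card ≤ (Finset.Ioi c.row).card := by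
    refine Finset.card_image_le.trans (Finset.card_le_card_of_injOn Node.row ?_ ?_)
    · intro d hd
      simp only [Finset.coe_filter, Finset.mem_univ, true_and, Set.mem_ofPred_eq] at hd
      rw [Finset.mem_coe, Finset.mem_Ioi]
      by_contra h
      have h2 := l.2 (not_lt.1 h)
      have h3 := Node.le_of_pos (c := c) (by omega)
      have h4 := Node.le_of_neg (c := d) (by omega)
      omega
    · intro d hd e he h
      simp only [Finset.coe_filter, Finset.mem_univ, true_and, Set.mem_ofPred_eq] at hd he
      exact Node.ext' h (by omega)
  rw [Fin.card_Ioi] at h1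
  have := c.row.2
  omega

/-- The condition on the first columns, in terms of counting. -/
lemma first_col_iff (hneg : ∀ c : l.Node, c.col < 0 → (T c).1 ≤ -1) (c : l.Node)
    (hc : c.col = 1) (hpos : 1 ≤ (T c).1) :
    ((Nat.nth (fun k => k ∈ Finset.Icc 1 n \ T.negColumn) (c.row : ℕ) : ℕ) : ℤ) ≤ (T c).1 ↔
      (c.row : ℤ) + 1 + ((T.negColumn.filter fun k : ℕ => (k : ℤ) ≤ (T c).1).card : ℤ) ≤ (T c).1 := by
  set p : ℕ → Prop := fun k => k ∈ Finset.Icc 1 n \ T.negColumn with hp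
  obtain ⟨N, hN⟩ := Int.eq_ofNat_of_zero_le (by omega : 0 ≤ (T c).1)
  have hNn : (T c).1 ≤ n := T.le_level c
  rw [hN] at hpos hNn ⊢
  have hB : ∀ k ∈ T.negColumn, 1 ≤ k ∧ k ≤ n := by
    intro k hk
    obtain ⟨d, hd, rfl⟩ := mem_negColumn.1 hk
    have h1 := hneg d (by omega)
    have h2 := T.neg_level_le d
    omega
  -- The integers from `1` to `N` split into those missing from column `-1`, which `p` counts, and
  -- those present in it.
  have hcount : Nat.count p (N + 1) + (T.negColumn.filter fun k : ℕ => (k : ℤ) ≤ N).card = N := by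
    rw [Nat.count_eq_card_filter_range]
    have h1 : (Finset.range (N + 1)).filter p =
        Finset.Icc 1 N \ T.negColumn.filter fun k : ℕ => (k : ℤ) ≤ N := by
      ext k
      simp only [hp, Finset.mem_filter, Finset.mem_range, Finset.mem_sdiff, Finset.mem_Icc,
        Nat.cast_le]
      have : N ≤ n := by omega
      constructor
      · rintro ⟨h1, ⟨h2, h3⟩, h4⟩
        exact ⟨⟨h2, by omega⟩, fun h => h4 h.1⟩
      · rintro ⟨⟨h1, h2⟩, h3⟩
        exact ⟨by omega, ⟨h1, by omega⟩, fun h => h3 ⟨h, h2⟩⟩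
    have h2 : (T.negColumn.filter fun k : ℕ => (k : ℤ) ≤ N) ⊆ Finset.Icc 1 N := by
      intro k hk
      rw [Finset.mem_filter, Nat.cast_le] at hk
      exact Finset.mem_Icc.2 ⟨(hB k hk.1).1, hk.2⟩
    rw [h1, Finset.card_sdiff_add_card_eq_card h2, Nat.card_Icc, Nat.add_sub_cancel]
  -- On a finite set `Nat.nth` returns `0` past the last element; this bound excludes that default
  -- value.
  have hcard : ∀ hf : (Set.ofPred p).Finite, (c.row : ℕ) < hf.toFinset.card := by
    intro hf
    have h1 : hf.toFinset = Finset.Icc 1 n \ T.negColumn := by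
      ext k; simp [hp]
    have h2 : T.negColumn ⊆ Finset.Icc 1 n := fun k hk => Finset.mem_Icc.2 (hB k hk)
    have h3 := Finset.card_sdiff_add_card_eq_card h2
    have h4 := T.card_negColumn_add_lt c hc
    rw [Nat.card_Icc] at h3
    rw [h1]
    omega
  have key : Nat.nth p c.row ≤ N ↔ (c.row : ℕ) < Nat.count p (N + 1) := by
    constructor
    · intro h
      have h1 := Nat.count_monotone p (Nat.succ_le_succ h)
      rw [Nat.count_nth_succ hcard] at h1
      exact h1
    · intro h
      exact Nat.lt_succ_iff.1 (Nat.nth_lt_of_lt_count h)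
  rw [Nat.cast_le, key]
  omega

/-- Positive columns start in the top row, so strict increase from an entry at least `1` forces
this. It shows later that the bottom row loses all its positive nodes in the reduction. -/
lemma IsRational.row_lt (hT : T.IsRational) (c : l.Node) (hc : 0 < c.col) :
    (c.row : ℤ) < (T c).1 := by
  obtain ⟨k, hk⟩ : ∃ k, (c.row : ℕ) = k := ⟨_, rfl⟩
  induction k generalizing c with
  | zero =>
    have := hT.pos c hc
    omega
  | succ k ih =>
    have hlt : (⟨k, by omega⟩ : Fin n) < c.row := by
      rw [Fin.lt_def]; simp only; omega
    let d : l.Node := Node.of ⟨k, by omega⟩ c.col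
      (Or.inr ⟨hc, (Node.le_of_pos hc).trans (l.2 hlt.le)⟩)
    have h1 := ih d hc rfl
    have h2 := hT.col_strict d c rfl hlt
    simp only [d, Node.row_of] at h1 h2
    omega

/-- Mirror image of `row_lt`: negative columns end in the bottom row, with an entry at most `-1`. -/
lemma IsRational.le_row_sub (hT : T.IsRational) (c : l.Node) (hc : c.col < 0) :
    (T c).1 ≤ (c.row : ℤ) - n := by
  obtain ⟨k, hk⟩ : ∃ k, (c.row : ℕ) + 1 + k = n := ⟨n - (c.row + 1), by have := c.row.2; omega⟩
  induction k generalizing c with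
  | zero =>
    have := hT.neg c hc
    omega
  | succ k ih =>
    have hlt : c.row < (⟨c.row + 1, by omega⟩ : Fin n) := by
      rw [Fin.lt_def]; simp
    let d : l.Node := Node.of ⟨c.row + 1, by omega⟩ c.col
      (Or.inl ⟨(l.2 hlt.le).trans (Node.le_of_neg hc), by omega⟩)
    have h1 := ih d hc (by simp only [d, Node.row_of]; omega)
    have h2 := hT.col_strict c d rfl hlt
    simp only [d, Node.row_of] at h1 h2
    omega

/-- Every node contributes `1` or `-1` according to the sign of its column. The total determines the
last exponent once the other exponents are known from the reduced tableau. -/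
lemma sum_weight (hpos : ∀ c : l.Node, 0 < c.col → 1 ≤ (T c).1)
    (hneg : ∀ c : l.Node, c.col < 0 → (T c).1 ≤ -1) : ∑ k, T.weight k = ∑ i, l.1 i := by
  have hc : ∀ c : l.Node, ∑ k : Fin n, ((if (T c).1 = (k : ℤ) + 1 then (1 : ℤ) else 0) -
      if (T c).1 = -((k : ℤ) + 1) then 1 else 0) = if 0 < c.col then 1 else -1 := by
    intro c
    have h1 := T.le_level c
    have h2 := T.neg_level_le c
    rcases c.neg_or_pos with h | h
    · have h3 := hneg c h
      rw [if_neg (by omega), Finset.sum_eq_single (⟨(-(T c).1 - 1).toNat, by omega⟩ : Fin n)]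
      · rw [if_neg (by simp only; omega), if_pos (by simp only; omega)]; rfl
      · intro b _ hb
        rw [ne_eq, Fin.ext_iff] at hb
        simp only at hb
        rw [if_neg (by omega), if_neg (by omega)]; rfl
      · simp
    · have h3 := hpos c h
      rw [if_pos h, Finset.sum_eq_single (⟨((T c).1 - 1).toNat, by omega⟩ : Fin n)]
      · rw [if_pos (by simp only; omega), if_neg (by simp only; omega)]; rfl
      · intro b _ hb
        rw [ne_eq, Fin.ext_iff] at hb
        simp only at hb
        rw [if_neg (by omega), if_neg (by omega)]; rfl
      · simp
  have hw : ∀ k, T.weight k = ∑ c : l.Node, ((if (T c).1 = (k : ℤ) + 1 then (1 : ℤ) else 0) -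
      if (T c).1 = -((k : ℤ) + 1) then 1 else 0) := by
    intro k
    rw [weight, Finset.sum_sub_distrib, Finset.sum_boole, Finset.sum_boole]
  rw [Finset.sum_congr rfl fun k _ => hw k, Finset.sum_comm, Finset.sum_congr rfl fun c _ => hc c,
    Fintype.sum_sigma]
  refine Finset.sum_congr rfl fun i _ => ?_
  have h1 : ∀ j : ↥(Finset.Icc (l.1 i) (-1) ∪ Finset.Icc 1 (l.1 i)),
      (if 0 < Node.col (⟨i, j⟩ : l.Node) then (1 : ℤ) else -1) =
        (fun j : ℤ => if 0 < j then (1 : ℤ) else -1) j := fun j => rfl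
  rw [Finset.sum_congr rfl fun j _ => h1 j,
    Finset.sum_coe_sort _ (fun j : ℤ => if 0 < j then (1 : ℤ) else -1), Finset.sum_union]
  · rw [Finset.sum_congr rfl (g := fun _ => (-1 : ℤ)), Finset.sum_congr (s₁ := Finset.Icc 1 (l.1 i))
      rfl (g := fun _ => (1 : ℤ))]
    · simp only [Finset.sum_const, Int.card_Icc]
      simp only [nsmul_eq_mul]
      omega
    · intro j hj
      rw [Finset.mem_Icc] at hj
      rw [if_pos (by omega)]
    · intro j hj
      rw [Finset.mem_Icc] at hj
      rw [if_neg (by omega)]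
  · rw [Finset.disjoint_left]
    intro j hj hj'
    rw [Finset.mem_Icc] at hj hj'
    omega

end Filling

end GenPart

/-! ### Removing and restoring the entries of largest absolute value -/

/-- A cut between a down-closed set of positive and an up-closed set of negative integers. -/
lemma exists_cut (a b : ℤ) (hab : a ≤ b) (P Q : ℤ → Prop)
    (hP : ∀ j j', 1 ≤ j → j ≤ j' → j' ≤ b → P j' → P j) (hPa : ∀ j, 1 ≤ j → j ≤ a → P j)
    (hQ : ∀ j j', a ≤ j → j ≤ j' → j' ≤ -1 → Q j → Q j') (hQb : ∀ j, b ≤ j → j ≤ -1 → Q j)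
    (hPQ : 1 ≤ b → a ≤ -1 → P 1 → Q (-1) → False) :
    ∃ m, a ≤ m ∧ m ≤ b ∧ (∀ j, 1 ≤ j → j ≤ b → (P j ↔ j ≤ m)) ∧
      ∀ j, a ≤ j → j ≤ -1 → (Q j ↔ m ≤ j) := by
  by_cases h1 : 1 ≤ b ∧ P 1
  · obtain ⟨m, ⟨hm1, hmb, hm⟩, hmax⟩ := Int.exists_greatest_of_bdd
      (P := fun j => 1 ≤ j ∧ j ≤ b ∧ P j) ⟨b, fun z hz => hz.2.1⟩ ⟨1, le_rfl, h1⟩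
    refine ⟨m, ?_, hmb, fun j hj hjb => ⟨fun h => hmax j ⟨hj, hjb, h⟩,
      fun h => hP j m hj h hmb hm⟩, fun j hj hj1 => ⟨fun h => ?_, fun h => by omega⟩⟩
    · by_cases ha : 1 ≤ a
      · exact hmax a ⟨ha, hab, hPa a ha le_rfl⟩
      · omega
    · exact (hPQ h1.1 (hj.trans hj1) h1.2 (hQ j (-1) hj hj1 le_rfl h)).elim
  · by_cases h2 : a ≤ -1 ∧ Q (-1)
    · obtain ⟨m, ⟨hm1, hma, hm⟩, hmin⟩ := Int.exists_least_of_bdd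
        (P := fun j => j ≤ -1 ∧ a ≤ j ∧ Q j) ⟨a, fun z hz => hz.2.1⟩ ⟨-1, le_rfl, h2⟩
      refine ⟨m, hma, ?_, fun j hj hjb => ⟨fun h => ?_, fun h => by omega⟩,
        fun j hj hj1 => ⟨fun h => hmin j ⟨hj1, hj, h⟩, fun h => hQ m j hma h hj1 hm⟩⟩
      · by_cases hb : b ≤ -1
        · exact hmin b ⟨hb, hab, hQb b le_rfl hb⟩
        · omega
      · exact (h1 ⟨hj.trans hjb, hP 1 j le_rfl hj hjb h⟩).elim
    -- Neither set meets the relevant range, and the cut at `0` makes the right-hand sides of both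
    -- equivalences false.
    · refine ⟨0, ?_, ?_, fun j hj hjb => ⟨fun h => ?_, fun h => by omega⟩,
        fun j hj hj1 => ⟨fun h => ?_, fun h => by omega⟩⟩
      · by_contra h
        exact h1 ⟨by omega, hPa 1 le_rfl (by omega)⟩
      · by_contra h
        exact h2 ⟨by omega, hQb (-1) (by omega) le_rfl⟩
      · exact (h1 ⟨hj.trans hjb, hP 1 j le_rfl hj hjb h⟩).elim
      · exact (h2 ⟨hj.trans hj1, hQ j (-1) hj hj1 le_rfl h⟩).elim

namespace GenPart

variable {n : ℕ} {l : GenPart (n + 1)} {m : GenPart n}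

/-- The inclusion of diagrams for interlacing shapes: rows of positive nodes keep their distance
to the top, rows of negative nodes keep their distance to the bottom. -/
def Node.emb (h : m.1 ∈ interlacing l.1) (c : m.Node) : l.Node :=
  if hc : 0 < c.col then
    Node.of c.row.castSucc c.col
      (Or.inr ⟨hc, (Node.le_of_pos hc).trans (mem_interlacing.1 h c.row).2⟩)
  else
    Node.of c.row.succ c.col (Or.inl ⟨(mem_interlacing.1 h c.row).1.trans
      (Node.le_of_neg (c.neg_or_pos.resolve_right hc)),
      Int.le_sub_one_of_lt (c.neg_or_pos.resolve_right hc)⟩)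

namespace Node

variable (h : m.1 ∈ interlacing l.1)

@[simp] lemma col_emb (c : m.Node) : (emb h c).col = c.col := by
  unfold emb; split_ifs <;> rfl

lemma row_emb_of_pos {c : m.Node} (hc : 0 < c.col) : (emb h c).row = c.row.castSucc := by
  unfold emb; rw [dif_pos hc]; rfl

lemma row_emb_of_neg {c : m.Node} (hc : c.col < 0) : (emb h c).row = c.row.succ := by
  unfold emb; rw [dif_neg hc.not_gt]; rfl

lemma row_emb_eq_iff {c d : m.Node} (hcd : 0 < c.col ↔ 0 < d.col) :
    (emb h c).row = (emb h d).row ↔ c.row = d.row := by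
  rcases c.neg_or_pos with hc | hc
  · have hd : d.col < 0 := d.neg_or_pos.resolve_right fun hd => hc.not_gt (hcd.2 hd)
    rw [row_emb_of_neg h hc, row_emb_of_neg h hd, Fin.succ_inj]
  · rw [row_emb_of_pos h hc, row_emb_of_pos h (hcd.1 hc), Fin.castSucc_inj]

lemma row_emb_lt_iff {c d : m.Node} (hcd : 0 < c.col ↔ 0 < d.col) :
    (emb h c).row < (emb h d).row ↔ c.row < d.row := by
  rcases c.neg_or_pos with hc | hc
  · have hd : d.col < 0 := d.neg_or_pos.resolve_right fun hd => hc.not_gt (hcd.2 hd)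
    rw [row_emb_of_neg h hc, row_emb_of_neg h hd, Fin.succ_lt_succ_iff]
  · rw [row_emb_of_pos h hc, row_emb_of_pos h (hcd.1 hc), Fin.castSucc_lt_castSucc_iff]

lemma emb_injective : Function.Injective (emb h) := by
  intro c d hcd
  have h1 : c.col = d.col := by rw [← col_emb h c, hcd, col_emb]
  exact ext' ((row_emb_eq_iff h (by rw [h1])).1 (by rw [hcd])) h1

lemma mem_range_emb_of_pos {c : l.Node} (hc : 0 < c.col) :
    c ∈ Set.range (emb h) ↔ ∃ i, Fin.castSucc i = c.row ∧ c.col ≤ m.1 i := by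
  constructor
  · rintro ⟨d, rfl⟩
    rw [col_emb] at hc ⊢
    exact ⟨d.row, (row_emb_of_pos h hc).symm, le_of_pos hc⟩
  · rintro ⟨i, hi, hm⟩
    exact ⟨of i c.col (Or.inr ⟨hc, hm⟩), ext' ((row_emb_of_pos h hc).trans hi) (col_emb h _)⟩

lemma mem_range_emb_of_neg {c : l.Node} (hc : c.col < 0) :
    c ∈ Set.range (emb h) ↔ ∃ i, Fin.succ i = c.row ∧ m.1 i ≤ c.col := by
  constructor
  · rintro ⟨d, rfl⟩
    rw [col_emb] at hc ⊢
    exact ⟨d.row, (row_emb_of_neg h hc).symm, le_of_neg hc⟩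
  · rintro ⟨i, hi, hm⟩
    exact ⟨of i c.col (Or.inl ⟨hm, by omega⟩), ext' ((row_emb_of_neg h hc).trans hi) (col_emb h _)⟩

end Node

namespace Filling

/-- `T` extends `T'` by entries `n + 1` and `-(n + 1)`. -/
structure Extends (h : m.1 ∈ interlacing l.1) (T : l.Filling) (T' : m.Filling) : Prop where
  emb : ∀ c, (T (Node.emb h c)).1 = (T' c).1
  pos : ∀ c ∉ Set.range (Node.emb h), 0 < c.col → (T c).1 = n + 1
  neg : ∀ c ∉ Set.range (Node.emb h), c.col < 0 → (T c).1 = -(n + 1)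

variable {h : m.1 ∈ interlacing l.1} {T : l.Filling} {T' : m.Filling}

open Classical in
/-- The extension of a filling by entries `n + 1` and `-(n + 1)`. -/
noncomputable def extension (h : m.1 ∈ interlacing l.1) (T' : m.Filling) : l.Filling := fun c =>
  if hc : c ∈ Set.range (Node.emb h) then
    ⟨(T' hc.choose).1, by
      have h1 := T'.le_level hc.choose
      have h2 := T'.neg_level_le hc.choose
      rw [Finset.mem_Icc]; push_cast; omega⟩
  else ⟨if 0 < c.col then n + 1 else -(n + 1), by
      rw [Finset.mem_Icc]; push_cast; split_ifs <;> omega⟩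

lemma extends_extension (h : m.1 ∈ interlacing l.1) (T' : m.Filling) :
    Extends h (extension h T') T' where
  emb c := by
    have hc : Node.emb h c ∈ Set.range (Node.emb h) := ⟨c, rfl⟩
    rw [extension, dif_pos hc]
    exact congrArg (fun d => (T' d).1) (Node.emb_injective h hc.choose_spec)
  pos c hc hc' := by rw [extension, dif_neg hc]; simp only; rw [if_pos hc']
  neg c hc hc' := by rw [extension, dif_neg hc]; simp only; rw [if_neg hc'.not_gt]

namespace Extends

lemma eq_extension (hT : Extends h T T') : T = extension h T' := by
  have hE := extends_extension h T'
  funext c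
  apply Subtype.ext
  by_cases hc : c ∈ Set.range (Node.emb h)
  · obtain ⟨d, rfl⟩ := hc
    rw [hT.emb, hE.emb]
  · rcases c.neg_or_pos with h1 | h1
    · rw [hT.neg c hc h1, hE.neg c hc h1]
    · rw [hT.pos c hc h1, hE.pos c hc h1]

lemma mem_range_iff (hT : Extends h T T') (c : l.Node) :
    c ∈ Set.range (Node.emb h) ↔ -(n : ℤ) ≤ (T c).1 ∧ (T c).1 ≤ n := by
  constructor
  · rintro ⟨d, rfl⟩
    rw [hT.emb]
    exact ⟨T'.neg_level_le d, T'.le_level d⟩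
  · intro hc
    by_contra h0
    rcases c.neg_or_pos with h1 | h1
    · have := hT.neg c h0 h1
      omega
    · have := hT.pos c h0 h1
      omega

lemma weight (hT : Extends h T T') (k : Fin n) : T.weight k.castSucc = T'.weight k := by
  have key : ∀ z : ℤ, -(n : ℤ) ≤ z → z ≤ n →
      (Finset.univ.filter fun c : l.Node => (T c).1 = z).card =
      (Finset.univ.filter fun c : m.Node => (T' c).1 = z).card := by
    intro z h1 h2
    symm
    refine Finset.card_bij (fun c _ => Node.emb h c) ?_
      (fun c _ d _ hcd => Node.emb_injective h hcd) ?_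
    · intro c hc
      rw [Finset.mem_filter] at hc ⊢
      exact ⟨Finset.mem_univ _, by rw [hT.emb, hc.2]⟩
    · intro c hc
      rw [Finset.mem_filter] at hc
      obtain ⟨d, rfl⟩ := (hT.mem_range_iff c).2 (by rw [hc.2]; exact ⟨h1, h2⟩)
      exact ⟨d, Finset.mem_filter.2 ⟨Finset.mem_univ _, by rw [← hT.emb, hc.2]⟩, rfl⟩
  have := k.2
  rw [Filling.weight, Filling.weight, Fin.val_castSucc, key _ (by omega) (by omega),
    key _ (by omega) (by omega)]

/-- The counting form of the first-column condition at an entry at most `n` sees only small elements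
of column `-1`, so it reads the same in `T` and in `T'`. -/
lemma filter_negColumn (hT : Extends h T T') (N : ℤ) (hN : N ≤ n) :
    (T.negColumn.filter fun k : ℕ => (k : ℤ) ≤ N) =
      T'.negColumn.filter fun k : ℕ => (k : ℤ) ≤ N := by
  ext k
  rw [Finset.mem_filter, Finset.mem_filter, and_congr_left_iff, mem_negColumn, mem_negColumn]
  intro hk
  constructor
  · rintro ⟨c, hc, hck⟩
    obtain ⟨d, rfl⟩ := (hT.mem_range_iff c).2 (by omega)
    exact ⟨d, by rwa [Node.col_emb] at hc, by rwa [hT.emb] at hck⟩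
  · rintro ⟨d, hd, hdk⟩
    exact ⟨Node.emb h d, by rwa [Node.col_emb], by rwa [hT.emb]⟩

lemma isRational_right (hT : Extends h T T') (hR : T.IsRational) : T'.IsRational := by
  have hpos : ∀ c : m.Node, 0 < c.col → 1 ≤ (T' c).1 := fun c hc => by
    rw [← hT.emb]; exact hR.pos _ (by rwa [Node.col_emb])
  have hneg : ∀ c : m.Node, c.col < 0 → (T' c).1 ≤ -1 := fun c hc => by
    rw [← hT.emb]; exact hR.neg _ (by rwa [Node.col_emb])
  refine ⟨hpos, hneg, fun c d h1 h2 => ?_, fun c d h1 h2 => ?_, fun c hc => ?_⟩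
  · rw [← hT.emb, ← hT.emb]
    refine hR.row_weak _ _ ((Node.row_emb_eq_iff h
      ⟨Node.pos_of_row_eq h1, Node.pos_of_row_eq h1.symm⟩).2 h1) ?_
    rwa [Node.col_emb, Node.col_emb]
  · rw [← hT.emb, ← hT.emb]
    refine hR.col_strict _ _ ?_ ((Node.row_emb_lt_iff h (by rw [h1])).2 h2)
    rwa [Node.col_emb, Node.col_emb]
  · have hc0 : 0 < c.col := by omega
    have hc' : (Node.emb h c).col = 1 := by rwa [Node.col_emb]
    rw [first_col_iff hneg c hc (hpos c hc0), ← hT.filter_negColumn _ (T'.le_level c)]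
    have h1 := (first_col_iff hR.neg _ hc' (hR.pos _ (by omega))).1 (hR.first_col _ hc')
    rw [hT.emb, Node.row_emb_of_pos h hc0] at h1
    exact h1

/-- Interlacing makes the added positive nodes, and likewise the added negative ones, a horizontal
strip; so no two new nodes share a column, and within rows and columns new entries fall on the
correct side of old ones. For a new entry in column `1` the first-column condition is just the bound
on the number of rows. -/
lemma isRational_left (hT : Extends h T T') (hR : T'.IsRational) : T.IsRational := by
  have hpos : ∀ c : l.Node, 0 < c.col → 1 ≤ (T c).1 := fun c hc => by
    by_cases h0 : c ∈ Set.range (Node.emb h)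
    · obtain ⟨d, rfl⟩ := h0
      rw [hT.emb]; exact hR.pos _ (by rwa [Node.col_emb] at hc)
    · rw [hT.pos c h0 hc]; omega
  have hneg : ∀ c : l.Node, c.col < 0 → (T c).1 ≤ -1 := fun c hc => by
    by_cases h0 : c ∈ Set.range (Node.emb h)
    · obtain ⟨d, rfl⟩ := h0
      rw [hT.emb]; exact hR.neg _ (by rwa [Node.col_emb] at hc)
    · rw [hT.neg c h0 hc]; omega
  have hle := T.le_level
  have hge := T.neg_level_le
  push_cast at hle hge
  refine ⟨hpos, hneg, fun c d h1 h2 => ?_, fun c d h1 h2 => ?_, fun c hc => ?_⟩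
  · by_cases hc : c ∈ Set.range (Node.emb h) <;> by_cases hd : d ∈ Set.range (Node.emb h)
    · obtain ⟨c, rfl⟩ := hc
      obtain ⟨d, rfl⟩ := hd
      have h3 : 0 < c.col ↔ 0 < d.col := by
        rw [← Node.col_emb h c, ← Node.col_emb h d]
        exact ⟨Node.pos_of_row_eq h1, Node.pos_of_row_eq h1.symm⟩
      rw [hT.emb, hT.emb]
      rw [Node.col_emb, Node.col_emb] at h2
      exact hR.row_weak _ _ ((Node.row_emb_eq_iff h h3).1 h1) h2
    · rcases d.neg_or_pos with h3 | h3
      · exfalso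
        rw [Node.mem_range_emb_of_neg h (by omega)] at hc
        rw [Node.mem_range_emb_of_neg h h3] at hd
        obtain ⟨i, hi, him⟩ := hc
        exact hd ⟨i, hi.trans h1, him.trans h2⟩
      · rw [hT.pos d hd h3]; exact hle c
    · rcases c.neg_or_pos with h3 | h3
      · rw [hT.neg c hc h3]; exact hge d
      · exfalso
        rw [Node.mem_range_emb_of_pos h h3] at hc
        rw [Node.mem_range_emb_of_pos h (by omega)] at hd
        obtain ⟨i, hi, him⟩ := hd
        exact hc ⟨i, hi.trans h1.symm, h2.trans him⟩
    · rcases c.neg_or_pos with h3 | h3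
      · rw [hT.neg c hc h3]; exact hge d
      · rw [hT.pos d hd (by omega)]; exact hle c
  · by_cases hc : c ∈ Set.range (Node.emb h) <;> by_cases hd : d ∈ Set.range (Node.emb h)
    · obtain ⟨c, rfl⟩ := hc
      obtain ⟨d, rfl⟩ := hd
      rw [Node.col_emb, Node.col_emb] at h1
      rw [hT.emb, hT.emb]
      exact hR.col_strict _ _ h1 ((Node.row_emb_lt_iff h (by rw [h1])).1 h2)
    · rcases d.neg_or_pos with h3 | h3
      · exfalso
        rw [Node.mem_range_emb_of_neg h h3] at hd
        obtain ⟨i, hi⟩ := Fin.exists_succ_eq.2 (Fin.ne_zero_of_lt h2)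
        refine hd ⟨i, hi, ((mem_interlacing.1 h i).2.trans (l.2 ?_)).trans
          (Node.le_of_neg (c := c) (by omega) |>.trans h1.le)⟩
        rw [← hi] at h2
        exact Fin.le_castSucc_iff.2 h2
      · have := ((hT.mem_range_iff c).1 hc).2
        rw [hT.pos d hd h3]; omega
    · rcases c.neg_or_pos with h3 | h3
      · have := ((hT.mem_range_iff d).1 hd).1
        rw [hT.neg c hc h3]; omega
      · exfalso
        rw [Node.mem_range_emb_of_pos h h3] at hc
        obtain ⟨i, hi⟩ := Fin.exists_castSucc_eq.2 (Fin.ne_last_of_lt h2)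
        refine hc ⟨i, hi, (h1.le.trans (Node.le_of_pos (by omega))).trans
          ((l.2 ?_).trans (mem_interlacing.1 h i).1)⟩
        rw [← hi] at h2
        exact Fin.castSucc_lt_iff_succ_le.1 h2
    · exfalso
      rcases c.neg_or_pos with h3 | h3
      · rw [Node.mem_range_emb_of_neg h (by omega)] at hd
        obtain ⟨i, hi⟩ := Fin.exists_succ_eq.2 (Fin.ne_zero_of_lt h2)
        refine hd ⟨i, hi, ((mem_interlacing.1 h i).2.trans (l.2 ?_)).trans
          (Node.le_of_neg h3 |>.trans h1.le)⟩
        rw [← hi] at h2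
        exact Fin.le_castSucc_iff.2 h2
      · rw [Node.mem_range_emb_of_pos h h3] at hc
        obtain ⟨i, hi⟩ := Fin.exists_castSucc_eq.2 (Fin.ne_last_of_lt h2)
        refine hc ⟨i, hi, (h1.le.trans (Node.le_of_pos (by omega))).trans
          ((l.2 ?_).trans (mem_interlacing.1 h i).1)⟩
        rw [← hi] at h2
        exact Fin.castSucc_lt_iff_succ_le.1 h2
  · rw [first_col_iff hneg c hc (hpos c (by omega))]
    by_cases h0 : c ∈ Set.range (Node.emb h)
    · obtain ⟨d, rfl⟩ := h0
      rw [Node.col_emb] at hc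
      have hd : 0 < d.col := by omega
      rw [hT.emb, Node.row_emb_of_pos h hd, hT.filter_negColumn _ (T'.le_level d)]
      exact (first_col_iff hR.neg d hc (hR.pos _ hd)).1 (hR.first_col d hc)
    · rw [hT.pos c h0 (by omega)]
      have h1 := T.card_negColumn_add_lt c hc
      have h2 := Finset.card_filter_le T.negColumn fun k : ℕ => (k : ℤ) ≤ n + 1
      omega

end Extends

end Filling

end GenPart

/-! ### Every rational tableau arises by a unique extension -/

namespace GenPart

variable {n : ℕ} {l : GenPart (n + 1)}

namespace Filling

variable {T : l.Filling}

/-- The entries of absolute value at most `n` cannot collide in a row of the reduced shape. -/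
lemma IsRational.not_collide (hT : T.IsRational) (i : Fin n) (c d : l.Node)
    (hc : c.row = i.castSucc) (hd : d.row = i.succ) (hc1 : c.col = 1) (hd1 : d.col = -1)
    (hcT : (T c).1 ≤ n) (hdT : -(n : ℤ) ≤ (T d).1) : False := by
  have hFC := (first_col_iff hT.neg c hc1 (hT.pos c (by omega))).1 (hT.first_col c hc1)
  have hdl := Node.le_of_neg (c := d) (by omega)
  have hnode : ∀ r : Fin (n + 1), i.castSucc < r → l.1 r ≤ -1 := by
    intro r hr
    have h2 : d.row ≤ r := by rw [hd]; exact Fin.castSucc_lt_iff_succ_le.1 hr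
    have := l.2 h2
    omega
  -- All `n - i` rows below row `i` meet column `-1`, with absolute values decreasing downwards,
  -- hence all at most `n`. But the first-column condition at `c` leaves at most `(T c).1 - i - 1`
  -- of them up to `(T c).1`, and at most `n - (T c).1` lie above: one too few.
  have hcard : n - i ≤ (T.negColumn.filter fun k : ℕ => k ≤ n).card := by
    have h1 : (Finset.Ioi i.castSucc).card = n - i := by
      rw [Fin.card_Ioi, Fin.val_castSucc]; omega
    rw [← h1]
    let f : Fin (n + 1) → ℕ := fun r =>
      if h : l.1 r ≤ -1 then (T (Node.of r (-1) (Or.inl ⟨h, le_rfl⟩))).1.natAbs else 0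
    have hanti : ∀ r s : Fin (n + 1), i.castSucc < r → r < s → f s < f r := by
      intro r s hr hrs
      simp only [f]
      rw [dif_pos (hnode r hr), dif_pos (hnode s (hr.trans hrs))]
      have h2 := hT.col_strict (Node.of r (-1) (Or.inl ⟨hnode r hr, le_rfl⟩))
        (Node.of s (-1) (Or.inl ⟨hnode s (hr.trans hrs), le_rfl⟩)) rfl hrs
      have h3 := hT.neg (Node.of s (-1) (Or.inl ⟨hnode s (hr.trans hrs), le_rfl⟩))
        (by rw [Node.col_of]; norm_num)
      omega
    refine Finset.card_le_card_of_injOn f ?_ ?_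
    · intro r hr
      rw [Finset.mem_coe, Finset.mem_Ioi] at hr
      rw [Finset.mem_coe, Finset.mem_filter, mem_negColumn]
      refine ⟨⟨Node.of r (-1) (Or.inl ⟨hnode r hr, le_rfl⟩), rfl, ?_⟩, ?_⟩
      · simp only [f]
        rw [dif_pos (hnode r hr)]
      · have h2 : f r ≤ f i.succ := by
          rcases (Fin.castSucc_lt_iff_succ_le.1 hr).eq_or_lt with h3 | h3
          · rw [h3]
          · exact (hanti _ _ i.castSucc_lt_succ h3).le
        refine h2.trans ?_
        simp only [f]
        rw [dif_pos (hnode _ i.castSucc_lt_succ)]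
        have h3 : Node.of i.succ (-1) (Or.inl ⟨hnode _ i.castSucc_lt_succ, le_rfl⟩) = d :=
          Node.ext' hd.symm hd1.symm
        rw [h3]
        have := hT.neg d (by omega)
        omega
    · intro r hr s hs hrs
      rw [Finset.mem_coe, Finset.mem_Ioi] at hr hs
      rcases lt_trichotomy r s with h2 | h2 | h2
      · exact absurd hrs (hanti r s hr h2).ne'
      · exact h2
      · exact absurd hrs (hanti s r hs h2).ne
  obtain ⟨N, hN⟩ := Int.eq_ofNat_of_zero_le ((hT.pos c (by omega)).trans' zero_le_one)
  have hsub : (T.negColumn.filter fun k : ℕ => k ≤ n) ⊆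
      (T.negColumn.filter fun k : ℕ => (k : ℤ) ≤ (T c).1) ∪ Finset.Ioc N n := by
    intro k hk
    rw [Finset.mem_filter] at hk
    rw [Finset.mem_union, Finset.mem_filter, Finset.mem_Ioc]
    by_cases h : k ≤ N
    · exact Or.inl ⟨hk.1, by omega⟩
    · exact Or.inr ⟨by omega, hk.2⟩
  have h3 := (Finset.card_le_card hsub).trans (Finset.card_union_le _ _)
  rw [Nat.card_Ioc] at h3
  rw [hc, Fin.val_castSucc] at hFC
  have := i.2
  omega

/-- One number `m` has to describe both the positive nodes kept in row `i` and the negative nodes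
kept in row `i + 1`. Such a cut exists because `not_collide` prevents both rows from keeping nodes.
-/
lemma IsRational.exists_interlacing (hT : T.IsRational) (i : Fin n) :
    ∃ m, l.1 i.succ ≤ m ∧ m ≤ l.1 i.castSucc ∧
      (∀ c : l.Node, c.row = i.castSucc → 0 < c.col → ((T c).1 ≤ n ↔ c.col ≤ m)) ∧
      (∀ c : l.Node, c.row = i.succ → c.col < 0 → (-(n : ℤ) ≤ (T c).1 ↔ m ≤ c.col)) := by
  have hle := T.le_level
  have hge := T.neg_level_le
  push_cast at hle hge
  refine Exists.elim (exists_cut (l.1 i.succ) (l.1 i.castSucc)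
    (l.2 i.castSucc_lt_succ.le)
    (fun j => ∀ c : l.Node, c.row = i.castSucc → c.col = j → (T c).1 ≤ n)
    (fun j => ∀ c : l.Node, c.row = i.succ → c.col = j → -(n : ℤ) ≤ (T c).1) ?_ ?_ ?_ ?_ ?_) ?_
  · intro j j' hj hjj hj' hP c hc hcj
    let d : l.Node := Node.of i.castSucc j' (Or.inr ⟨hj.trans hjj, hj'⟩)
    exact (hT.row_weak c d hc (hcj.trans_le hjj)).trans (hP d rfl rfl)
  · intro j hj hj' c hc hcj
    let d : l.Node := Node.of i.succ j (Or.inr ⟨hj, hj'⟩)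
    have h5 := hT.col_strict c d hcj (by rw [hc]; exact i.castSucc_lt_succ)
    have := hle d
    omega
  · intro j j' hj hjj hj' hQ c hc hcj
    let d : l.Node := Node.of i.succ j (Or.inl ⟨hj, hjj.trans hj'⟩)
    exact (hQ d rfl rfl).trans (hT.row_weak d c hc.symm (hjj.trans_eq hcj.symm))
  · intro j hj hj' c hc hcj
    let d : l.Node := Node.of i.castSucc j (Or.inl ⟨hj, hj'⟩)
    have h5 := hT.col_strict d c hcj.symm (by rw [hc]; exact i.castSucc_lt_succ)
    have := hge d
    omega
  · intro hb ha hP hQ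
    exact hT.not_collide i (Node.of i.castSucc 1 (Or.inr ⟨le_rfl, hb⟩))
      (Node.of i.succ (-1) (Or.inl ⟨ha, le_rfl⟩)) rfl rfl rfl rfl (hP _ rfl rfl) (hQ _ rfl rfl)
  · rintro m ⟨h1, h2, h3, h4⟩
    refine ⟨m, h1, h2, fun c hc hc' => ?_, fun c hc hc' => ?_⟩
    · have h := Node.le_of_pos hc'
      rw [hc] at h
      rw [← h3 c.col hc' h]
      exact ⟨fun h d hd hd' => by rwa [Node.ext' (hd.trans hc.symm) hd'], fun h => h c hc rfl⟩
    · have h := Node.le_of_neg hc'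
      rw [hc] at h
      rw [← h4 c.col h (by omega)]
      exact ⟨fun h d hd hd' => by rwa [Node.ext' (hd.trans hc.symm) hd'], fun h => h c hc rfl⟩

lemma IsRational.exists_extends (hT : T.IsRational) :
    ∃ (m : GenPart n) (h : m.1 ∈ interlacing l.1) (T' : m.Filling), Extends h T T' := by
  choose m h1 h2 h3 h4 using hT.exists_interlacing
  have hle := T.le_level
  have hge := T.neg_level_le
  push_cast at hle hge
  have hanti : Antitone m := by
    intro i j hij
    rcases hij.eq_or_lt with rfl | hij
    · exact le_rfl
    · exact (h2 j).trans ((l.2 (Fin.succ_le_castSucc_iff.2 hij)).trans (h1 i))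
  have h : (⟨m, hanti⟩ : GenPart n).1 ∈ interlacing l.1 :=
    mem_interlacing.2 fun i => ⟨h1 i, h2 i⟩
  have hpos : ∀ c : l.Node, 0 < c.col → ((T c).1 ≤ n ↔ c ∈ Set.range (Node.emb h)) := by
    intro c hc
    rw [Node.mem_range_emb_of_pos h hc]
    constructor
    · intro hn
      have h5 := hT.row_lt c hc
      -- The last row has no counterpart among the positive rows of `m`, but by `row_lt` its
      -- positive entries exceed `n`.
      obtain ⟨i, hi⟩ := Fin.exists_castSucc_eq.2 (fun h6 : c.row = Fin.last n => by
        rw [h6, Fin.val_last] at h5; omega)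
      exact ⟨i, hi, (h3 i c hi.symm hc).1 hn⟩
    · rintro ⟨i, hi, him⟩
      exact (h3 i c hi.symm hc).2 him
  have hneg : ∀ c : l.Node, c.col < 0 →
      (-(n : ℤ) ≤ (T c).1 ↔ c ∈ Set.range (Node.emb h)) := by
    intro c hc
    rw [Node.mem_range_emb_of_neg h hc]
    constructor
    · intro hn
      have h5 := hT.le_row_sub c hc
      obtain ⟨i, hi⟩ := Fin.exists_succ_eq.2 (fun h6 : c.row = 0 => by
        rw [h6, Fin.val_zero] at h5; push_cast at h5; omega)
      exact ⟨i, hi, (h4 i c hi.symm hc).1 hn⟩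
    · rintro ⟨i, hi, him⟩
      exact (h4 i c hi.symm hc).2 him
  refine ⟨⟨m, hanti⟩, h, fun c => ⟨(T (Node.emb h c)).1, ?_⟩, fun c => rfl, ?_, ?_⟩
  · rw [Finset.mem_Icc]
    rcases c.neg_or_pos with hc | hc
    · rw [← Node.col_emb h c] at hc
      have h5 := (hneg _ hc).2 ⟨c, rfl⟩
      have h6 := hT.neg _ hc
      omega
    · rw [← Node.col_emb h c] at hc
      have h5 := (hpos _ hc).2 ⟨c, rfl⟩
      have h6 := hT.pos _ hc
      omega
  · intro c hc hc'
    rw [← hpos c hc'] at hc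
    have := hle c
    omega
  · intro c hc hc'
    rw [← hneg c hc'] at hc
    have := hge c
    omega

/-- The nodes with entries of absolute value at most `n` form the image of the inner diagram and
thereby determine it. -/
lemma Extends.shape_unique {m m' : GenPart n} {h : m.1 ∈ interlacing l.1}
    {h' : m'.1 ∈ interlacing l.1} {T₁ : m.Filling} {T₂ : m'.Filling} (hT : Extends h T T₁)
    (hT' : Extends h' T T₂) : m = m' := by
  have key : ∀ c : l.Node, c ∈ Set.range (Node.emb h) ↔ c ∈ Set.range (Node.emb h') := fun c => by
    rw [hT.mem_range_iff, hT'.mem_range_iff]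
  have hlt : ∀ {m m' : GenPart n} (h : m.1 ∈ interlacing l.1) (h' : m'.1 ∈ interlacing l.1),
      (∀ c : l.Node, c ∈ Set.range (Node.emb h) ↔ c ∈ Set.range (Node.emb h')) →
      ∀ i, m'.1 i ≤ m.1 i := by
    intro m m' h h' key i
    by_contra hi
    have h1 := mem_interlacing.1 h i
    have h2 := mem_interlacing.1 h' i
    by_cases h0 : 0 < m'.1 i
    · have h3 := key (Node.of i.castSucc (m'.1 i) (Or.inr ⟨h0, h2.2⟩))
      rw [Node.mem_range_emb_of_pos (c := Node.of ..) _ h0,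
        Node.mem_range_emb_of_pos (c := Node.of ..) _ h0] at h3
      obtain ⟨j, hj, hj'⟩ := h3.2 ⟨i, rfl, le_rfl⟩
      rw [Fin.castSucc_injective _ hj] at hj'
      exact hi hj'
    · have h0' : m.1 i < 0 := by omega
      have h3 := key (Node.of i.succ (m.1 i) (Or.inl ⟨h1.1, by omega⟩))
      rw [Node.mem_range_emb_of_neg (c := Node.of ..) _ h0',
        Node.mem_range_emb_of_neg (c := Node.of ..) _ h0'] at h3
      obtain ⟨j, hj, hj'⟩ := h3.1 ⟨i, rfl, le_rfl⟩
      rw [Fin.succ_injective _ hj] at hj'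
      exact hi hj'
  exact Subtype.ext (funext fun i =>
    le_antisymm (hlt h' h (fun c => (key c).symm) i) (hlt h h' key i))

end Filling

lemma antitone_of_mem_interlacing {m : Fin n → ℤ} (h : m ∈ interlacing l.1) : Antitone m := by
  intro i j hij
  rw [mem_interlacing] at h
  rcases hij.eq_or_lt with rfl | hij
  · exact le_rfl
  · exact (h j).2.trans ((l.2 (Fin.succ_le_castSucc_iff.2 hij)).trans (h i).1)

open Classical in
/-- The rational tableaux of given shape and weight. -/
noncomputable def tableaux {n : ℕ} (l : GenPart n) (w : Fin n → ℤ) : Finset l.Filling :=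
  Finset.univ.filter fun T => T.IsRational ∧ T.weight = w

lemma mem_tableaux {n : ℕ} {l : GenPart n} {w : Fin n → ℤ} {T : l.Filling} :
    T ∈ l.tableaux w ↔ T.IsRational ∧ T.weight = w := by
  simp [tableaux]

open Classical in
lemma card_tableaux_succ (w : Fin (n + 1) → ℤ) (f : (Fin n → ℤ) → ℕ)
    (hf : ∀ m : GenPart n, f m.1 = (m.tableaux (Fin.init w)).card) :
    (l.tableaux w).card = ∑ m ∈ interlacing l.1,
      if ∑ i, l.1 i - ∑ i, m i = w (Fin.last n) then f m else 0 := by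
  -- The inner shape, well defined by `shape_unique`; the default `0` is never used on rational
  -- tableaux.
  let φ : l.Filling → Fin n → ℤ := fun T =>
    if hT : ∃ (m : GenPart n) (h : m.1 ∈ interlacing l.1) (T' : m.Filling), Filling.Extends h T T'
    then hT.choose.1 else 0
  have hφ : ∀ {m : GenPart n} {h : m.1 ∈ interlacing l.1} {T : l.Filling} {T' : m.Filling},
      Filling.Extends h T T' → φ T = m.1 := by
    intro m h T T' hT
    have hex : ∃ (m : GenPart n) (h : m.1 ∈ interlacing l.1) (T' : m.Filling),
      Filling.Extends h T T' := ⟨m, h, T', hT⟩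
    obtain ⟨h', T'', hT''⟩ := hex.choose_spec
    simp only [φ]
    rw [dif_pos hex]
    exact congrArg Subtype.val (hT''.shape_unique hT)
  have hex : ∀ T ∈ l.tableaux w, ∃ (m : GenPart n) (h : m.1 ∈ interlacing l.1) (T' : m.Filling),
      Filling.Extends h T T' := fun T hT => (mem_tableaux.1 hT).1.exists_extends
  have hlast : ∀ {m : GenPart n} {h : m.1 ∈ interlacing l.1} {T : l.Filling} {T' : m.Filling},
      Filling.Extends h T T' → T.IsRational →
        T.weight (Fin.last n) = ∑ i, l.1 i - ∑ i, m.1 i := by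
    intro m h T T' hT hR
    have hR' := hT.isRational_right hR
    have h1 := Filling.sum_weight hR.pos hR.neg
    have h2 := Filling.sum_weight hR'.pos hR'.neg
    rw [Fin.sum_univ_castSucc, Finset.sum_congr rfl fun k _ => hT.weight k] at h1
    linarith
  rw [Finset.card_eq_sum_card_fiberwise (f := φ) (t := interlacing l.1)]
  · refine Finset.sum_congr rfl fun v hv => ?_
    obtain ⟨m, rfl⟩ : ∃ m : GenPart n, m.1 = v := ⟨⟨v, antitone_of_mem_interlacing hv⟩, rfl⟩
    split_ifs with hw
    · rw [hf]
      symm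
      refine Finset.card_bij (fun T' _ => Filling.extension hv T') ?_ ?_ ?_
      · intro T' hT'
        rw [mem_tableaux] at hT'
        have hE := Filling.extends_extension hv T'
        have hR := hE.isRational_left hT'.1
        rw [Finset.mem_filter, mem_tableaux]
        refine ⟨⟨hR, ?_⟩, hφ hE⟩
        funext k
        refine Fin.lastCases ?_ (fun k => ?_) k
        · rw [hlast hE hR, hw]
        · rw [hE.weight, hT'.2]; rfl
      · intro T₁ _ T₂ _ h12
        funext c
        have h1 := (Filling.extends_extension hv T₁).emb c
        have h2 := (Filling.extends_extension hv T₂).emb c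
        rw [h12] at h1
        exact Subtype.ext (h1.symm.trans h2)
      · intro T hT
        rw [Finset.mem_filter] at hT
        obtain ⟨m', h', T', hE⟩ := hex T hT.1
        obtain rfl : m' = m := Subtype.ext ((hφ hE).symm.trans hT.2)
        have hT1 := mem_tableaux.1 hT.1
        refine ⟨T', mem_tableaux.2 ⟨hE.isRational_right hT1.1, ?_⟩, hE.eq_extension.symm⟩
        funext k
        rw [← hE.weight, hT1.2]; rfl
    · rw [Finset.card_eq_zero, Finset.filter_eq_empty_iff]
      intro T hT hTm
      obtain ⟨m', h', T', hE⟩ := hex T hT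
      obtain rfl : m' = m := Subtype.ext ((hφ hE).symm.trans hTm)
      have hT1 := mem_tableaux.1 hT
      exact hw (by rw [← hlast hE hT1.1, hT1.2])
  · intro T hT
    obtain ⟨m, h, T', hE⟩ := hex T hT
    rw [Finset.mem_coe, hφ hE]
    exact h

lemma card_tableaux {n : ℕ} (l : GenPart n) (w : Fin n → ℤ) :
    ((l.tableaux w).card : ℤ) = gtCount n l.1 w := by
  induction n with
  | zero =>
    have h : l.tableaux w = Finset.univ := by
      refine Finset.eq_univ_iff_forall.2 fun T => mem_tableaux.2 ⟨⟨?_, ?_, ?_, ?_, ?_⟩, ?_⟩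
      all_goals first | exact fun c => c.1.elim0 | exact Subsingleton.elim _ _
    have : IsEmpty l.Node := ⟨fun c => c.1.elim0⟩
    rw [h, Finset.card_univ, Fintype.card_unique]
    rfl
  | succ n ih =>
    rw [card_tableaux_succ w (fun m => (gtCount n m (Fin.init w)).toNat), gtCount, Nat.cast_sum]
    · refine Finset.sum_congr rfl fun m hm => ?_
      have h1 := ih ⟨m, antitone_of_mem_interlacing hm⟩ (Fin.init w)
      simp only at h1
      split_ifs
      · rw [← h1, Int.toNat_natCast]
      · rfl
    · intro m
      rw [← ih m, Int.toNat_natCast]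

lemma rationalSchur_coeff {n : ℕ} (l : GenPart n) (w : Fin n → ℤ) :
    (rationalSchur l).coeff w = gtCount n l.1 w := by
  classical
  rw [← card_tableaux, rationalSchur, AddMonoidAlgebra.coeff_sum, Finsupp.finsetSum_apply]
  simp only [AddMonoidAlgebra.coeff_single, Finsupp.single_apply]
  rw [Finset.sum_boole, Finset.filter_filter]
  rfl

end GenPart

/-! ### Unitriangularity and linear independence -/

/-- A linear endomorphism that is unitriangular with respect to a rank function is bijective. -/
lemma bijective_of_unitriangular {κ : Type*} (μ : κ → ℕ) (K : (κ →₀ ℤ) →ₗ[ℤ] (κ →₀ ℤ))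
    (h1 : ∀ l, K (Finsupp.single l 1) l = 1)
    (h2 : ∀ l m, K (Finsupp.single l 1) m ≠ 0 → m = l ∨ μ m < μ l) : Function.Bijective K := by
  have hsingle : ∀ (k : κ) (a : ℤ), Finsupp.single k a = a • Finsupp.single k (1 : ℤ) := by
    intro k a
    rw [Finsupp.smul_single, smul_eq_mul, mul_one]
  constructor
  · rw [injective_iff_map_eq_zero]
    intro f hf
    by_contra h0
    -- At an index of maximal rank in the support no other term contributes, so the coefficient of
    -- `K f` there is that of `f`.
    obtain ⟨l, hl, hmax⟩ := f.support.exists_max_image μ (Finsupp.support_nonempty_iff.2 h0)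
    have hKf : K f l = ∑ k ∈ f.support, f k * K (Finsupp.single k 1) l := by
      conv_lhs => rw [← Finsupp.sum_single f, Finsupp.sum, map_sum, Finsupp.finsetSum_apply]
      refine Finset.sum_congr rfl fun k _ => ?_
      rw [hsingle, map_smul, Finsupp.smul_apply, smul_eq_mul]
    rw [hf, Finset.sum_eq_single l, h1, mul_one] at hKf
    · exact Finsupp.mem_support_iff.1 hl hKf.symm
    · intro k hk hkl
      by_contra hne
      rcases h2 k l (right_ne_zero_of_mul hne) with h | h
      · exact hkl h.symm
      · exact absurd (hmax k hk) (not_le.2 h)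
    · exact fun h => absurd hl h
  · rw [← LinearMap.range_eq_top]
    have hmem : ∀ (N : ℕ) (l : κ), μ l = N → Finsupp.single l (1 : ℤ) ∈ LinearMap.range K := by
      intro N
      induction N using Nat.strong_induction_on with
      | _ N ih =>
        intro l hl
        set g := K (Finsupp.single l 1) - Finsupp.single l 1 with hg
        have hgr : g ∈ LinearMap.range K := by
          rw [← Finsupp.sum_single g]
          refine Submodule.sum_mem _ fun m hm => ?_
          rw [hsingle]
          refine Submodule.smul_mem _ _ (ih (μ m) ?_ m rfl)
          rw [Finsupp.mem_support_iff, hg, Finsupp.sub_apply] at hm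
          by_cases hml : m = l
          · rw [hml, h1, Finsupp.single_eq_same, sub_self] at hm
            exact absurd rfl hm
          · rw [Finsupp.single_eq_of_ne hml, sub_zero] at hm
            exact ((h2 l m hm).resolve_left hml).trans_eq hl
        have : Finsupp.single l (1 : ℤ) = K (Finsupp.single l 1) - g := by rw [hg]; abel
        rw [this]
        exact Submodule.sub_mem _ (LinearMap.mem_range_self _ _) hgr
    rw [eq_top_iff]
    intro f _
    rw [← Finsupp.sum_single f]
    refine Submodule.sum_mem _ fun m _ => ?_
    rw [hsingle]
    exact Submodule.smul_mem _ _ (hmem _ m rfl)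

namespace GenPart

/-- The pairing of a generalized partition with the sum of the positive coroots. -/
def height {n : ℕ} (l : GenPart n) : ℤ := ∑ i : Fin n, ((n : ℤ) - 1 - 2 * i) * l.1 i

lemma height_nonneg {n : ℕ} (l : GenPart n) : 0 ≤ l.height := by
  have h1 : l.height + l.height = ∑ i : Fin n, ((n : ℤ) - 1 - 2 * i) * (l.1 i - l.1 i.rev) := by
    have h2 : l.height = -∑ i : Fin n, ((n : ℤ) - 1 - 2 * i) * l.1 i.rev := by
      rw [height, ← Equiv.sum_comp Fin.revPerm, ← Finset.sum_neg_distrib]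
      refine Finset.sum_congr rfl fun i _ => ?_
      have := i.2
      rw [Fin.revPerm_apply, Fin.val_rev, Nat.cast_sub (by omega)]
      push_cast
      ring
    -- Only one of the two copies is to be reversed, so the first is turned back.
    conv_lhs => rw [h2]
    conv_lhs => enter [1]; rw [← h2]
    rw [height]
    simp only [mul_sub, Finset.sum_sub_distrib]
    ring
  have h2 : 0 ≤ ∑ i : Fin n, ((n : ℤ) - 1 - 2 * i) * (l.1 i - l.1 i.rev) := by
    refine Finset.sum_nonneg fun i _ => ?_
    have := i.2
    have h3 := Fin.val_rev i
    rcases le_total i i.rev with h | h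
    · have h4 := l.2 h
      rw [Fin.le_def] at h
      exact mul_nonneg (by omega) (by linarith)
    · have h4 := l.2 h
      rw [Fin.le_def] at h
      exact mul_nonneg_of_nonpos_of_nonpos (by omega) (by linarith)
  omega

/-- For a fixed sum of parts, the statistic of `gtCount_support` grows exactly as the height drops;
being nonnegative, the height serves as the rank for unitriangularity. -/
lemma height_eq {n : ℕ} (l : GenPart n) :
    l.height = ((n : ℤ) - 1) * ∑ i, l.1 i - 2 * ∑ i : Fin n, (i : ℤ) * l.1 i := by
  rw [height, Finset.mul_sum, Finset.mul_sum, ← Finset.sum_sub_distrib]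
  exact Finset.sum_congr rfl fun i _ => by ring

lemma star_star {n : ℕ} (l : GenPart n) : l.star.star = l := by
  apply Subtype.ext
  funext i
  simp [star]

lemma star_involutive (n : ℕ) : Function.Involutive (star : GenPart n → GenPart n) := star_star

end GenPart

/-- The coefficients of a Laurent polynomial at the dominant exponents. -/
noncomputable def dominantCoeff (n : ℕ) : LaurentPoly n →ₗ[ℤ] RatRep n :=
  Finsupp.lcomapDomain (fun l : GenPart n => l.1) Subtype.val_injective ∘ₗ
    (AddMonoidAlgebra.coeffLinearEquiv ℤ).toLinearMap

lemma dominantCoeff_apply {n : ℕ} (f : LaurentPoly n) (l : GenPart n) :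
    dominantCoeff n f l = f.coeff l.1 := rfl

lemma character_schurBasis {n : ℕ} (l : GenPart n) :
    character n (schurBasis l) = rationalSchur l := by
  rw [character, schurBasis, Finsupp.linearCombination_single, one_smul]

lemma bijective_dominantCoeff_character (n : ℕ) :
    Function.Bijective (dominantCoeff n ∘ₗ character n) := by
  have h : ∀ l m : GenPart n, (dominantCoeff n ∘ₗ character n) (Finsupp.single l 1) m =
      gtCount n l.1 m.1 := fun l m => by
    rw [LinearMap.comp_apply, dominantCoeff_apply, ← GenPart.rationalSchur_coeff,
      ← character_schurBasis]
    rfl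
  refine bijective_of_unitriangular (fun l : GenPart n => l.height.toNat) _ (fun l => ?_)
    (fun l m hne => ?_)
  · rw [h, gtCount_self n l.1 l.2]
  · rw [h] at hne
    obtain ⟨h1, h2⟩ := gtCount_support _ _ _ hne
    rcases h2 with h2 | h2
    · exact Or.inl (Subtype.ext h2)
    · right
      have h3 := l.height_eq
      have h4 := m.height_eq
      have h5 := m.height_nonneg
      rw [h1] at h4
      omega

lemma character_injective (n : ℕ) : Function.Injective (character n) :=
  Function.Injective.of_comp (f := dominantCoeff n) (bijective_dominantCoeff_character n).1

lemma character_coeff {n : ℕ} (f : RatRep n) (w : Fin n → ℤ) :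
    (character n f).coeff w = f.sum fun l a => a * gtCount n l.1 w := by
  rw [character, Finsupp.linearCombination_apply, AddMonoidAlgebra.coeff_finsuppSum,
    Finsupp.sum_apply]
  refine Finset.sum_congr rfl fun l _ => ?_
  beta_reduce
  rw [AddMonoidAlgebra.coeff_smul_apply, GenPart.rationalSchur_coeff, smul_eq_mul]

lemma character_coeff_perm {n : ℕ} (f : RatRep n) (w : Fin n → ℤ) (s : Equiv.Perm (Fin n)) :
    (character n f).coeff (w ∘ s) = (character n f).coeff w := by
  simp only [character_coeff, gtCount_perm]

/-- The key identity `s_{l*}(x) = s_l(x⁻¹)`, extended linearly. -/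
lemma character_starMap_coeff {n : ℕ} (f : RatRep n) (w : Fin n → ℤ) :
    (character n (starMap n f)).coeff w = (character n f).coeff (-w) := by
  rw [character_coeff, character_coeff, starMap, Finsupp.lmapDomain_apply,
    Finsupp.sum_mapDomain_index (by simp) (by intros; ring)]
  refine Finset.sum_congr rfl fun l _ => ?_
  beta_reduce
  rw [← gtCount_neg_rev n l.1 (-w)]
  congr 1
  congr 1
  funext i
  simp

/-! ### Two sets of variables and the comultiplication -/

/-- The linear functional on Laurent polynomials with given values at the monomials. -/
noncomputable def evalMonomials {n : ℕ} (F : (Fin n → ℤ) → ℤ) : LaurentPoly n →ₗ[ℤ] ℤ :=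
  Finsupp.linearCombination ℤ F ∘ₗ (AddMonoidAlgebra.coeffLinearEquiv ℤ).toLinearMap

lemma evalMonomials_apply {n : ℕ} (F : (Fin n → ℤ) → ℤ) (f : LaurentPoly n) :
    evalMonomials F f = f.coeff.sum fun w a => a * F w := rfl

lemma evalMonomials_single {n : ℕ} (F : (Fin n → ℤ) → ℤ) (w : Fin n → ℤ) (a : ℤ) :
    evalMonomials F (AddMonoidAlgebra.single w a) = a * F w := by
  rw [evalMonomials_apply, AddMonoidAlgebra.coeff_single, Finsupp.sum_single_index (zero_mul _)]

lemma evalMonomials_indicator {n : ℕ} (f : LaurentPoly n) (w : Fin n → ℤ) :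
    evalMonomials (Pi.single w 1) f = f.coeff w := by
  classical
  rw [evalMonomials_apply, Finsupp.sum]
  simp only [Pi.single_apply, mul_ite, mul_one, mul_zero]
  rw [Finset.sum_ite_eq']
  split_ifs with h
  · rfl
  · exact (Finsupp.notMem_support_iff.1 h).symm

lemma laurent_induction {n : ℕ} {P : LaurentPoly n → Prop} (f : LaurentPoly n)
    (zero : P 0) (add : ∀ f g, P f → P g → P (f + g))
    (single : ∀ w a, P (AddMonoidAlgebra.single w a)) : P f :=
  AddMonoidAlgebra.induction_linear f zero (fun f g => add f g) single

/-- The product of functions of exponent vectors, in separate sets of variables. -/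
def boxMul {p q : ℕ} (F : (Fin p → ℤ) → ℤ) (G : (Fin q → ℤ) → ℤ) : (Fin (p + q) → ℤ) → ℤ :=
  fun w => F (fun i => w (Fin.castAdd q i)) * G (fun i => w (Fin.natAdd p i))

lemma evalMonomials_boxMul {p q : ℕ} (F : (Fin p → ℤ) → ℤ) (G : (Fin q → ℤ) → ℤ)
    (f : LaurentPoly p) (g : LaurentPoly q) :
    evalMonomials (boxMul F G) (firstVars p q f * lastVars p q g) =
      evalMonomials F f * evalMonomials G g := by
  induction f using laurent_induction with
  | zero => simp
  | add f f' hf hf' => rw [map_add, add_mul, map_add, hf, hf', map_add, add_mul]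
  | single u a =>
    induction g using laurent_induction with
    | zero => simp
    | add g g' hg hg' => rw [map_add, mul_add, map_add, hg, hg', map_add, mul_add]
    | single v b =>
      rw [firstVars, lastVars, AddMonoidAlgebra.mapDomainLinearMap_single,
        AddMonoidAlgebra.mapDomainLinearMap_single, AddMonoidAlgebra.single_mul_single,
        evalMonomials_single, evalMonomials_single, evalMonomials_single, boxMul]
      simp only [Pi.add_apply, Fin.append_left, Fin.append_right, Pi.zero_apply, add_zero,
        zero_add]
      ring

lemma character₂_tmul {p q : ℕ} (f : RatRep p) (g : RatRep q) :
    character₂ p q (f ⊗ₜ g) =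
      firstVars p q (character p f) * lastVars p q (character q g) := rfl

lemma character₂_tmul_coeff {p q : ℕ} (f : RatRep p) (g : RatRep q) (u : Fin p → ℤ)
    (v : Fin q → ℤ) : (character₂ p q (f ⊗ₜ g)).coeff (Fin.append u v) =
      (character p f).coeff u * (character q g).coeff v := by
  classical
  rw [← evalMonomials_indicator, ← evalMonomials_indicator, ← evalMonomials_indicator,
    ← evalMonomials_boxMul, character₂_tmul]
  congr 2
  funext w
  obtain ⟨x, y, rfl⟩ : ∃ x y, w = Fin.append x y := ⟨_, _, (Fin.append_castAdd_natAdd).symm⟩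
  simp only [boxMul, Fin.append_left, Fin.append_right, Pi.single_apply]
  rw [ite_zero_mul_ite_zero, mul_one]
  refine if_congr ?_ rfl rfl
  constructor
  · intro h
    constructor
    · funext i
      simpa using congrFun h (Fin.castAdd q i)
    · funext i
      simpa using congrFun h (Fin.natAdd p i)
  · rintro ⟨h1, h2⟩
    change x = u at h1
    change y = v at h2
    rw [h1, h2]

lemma character₂_coeff_perm {p q : ℕ} (t : RatRep p ⊗[ℤ] RatRep q) (u : Fin p → ℤ)
    (v : Fin q → ℤ) (s : Equiv.Perm (Fin p)) (s' : Equiv.Perm (Fin q)) :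
    (character₂ p q t).coeff (Fin.append (u ∘ s) (v ∘ s')) =
      (character₂ p q t).coeff (Fin.append u v) := by
  induction t using TensorProduct.induction_on with
  | zero => simp
  | tmul f g => simp only [character₂_tmul_coeff, character_coeff_perm]
  | add x y hx hy =>
    rw [map_add, AddMonoidAlgebra.coeff_add, Finsupp.add_apply, Finsupp.add_apply, hx, hy]

lemma character_coeff_append_perm {p q : ℕ} (f : RatRep (p + q)) (u : Fin p → ℤ)
    (v : Fin q → ℤ) (s : Equiv.Perm (Fin p)) (s' : Equiv.Perm (Fin q)) :
    (character (p + q) f).coeff (Fin.append (u ∘ s) (v ∘ s')) =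
      (character (p + q) f).coeff (Fin.append u v) := by
  rw [← character_coeff_perm f (Fin.append u v)
    (finSumFinEquiv.permCongr (Equiv.Perm.sumCongr s s'))]
  congr 1
  funext i
  refine Fin.addCases (fun i => ?_) (fun i => ?_) i <;>
    simp [Equiv.permCongr_apply]

lemma exists_antitone_comp_perm {n : ℕ} (w : Fin n → ℤ) :
    ∃ s : Equiv.Perm (Fin n), Antitone (w ∘ s) :=
  ⟨Tuple.sort fun i => -w i, fun _ _ h =>
    neg_le_neg_iff.1 (Tuple.monotone_sort (fun i => -w i) h)⟩

/-- Coefficients at the pairs of dominant exponents. -/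
noncomputable def dominantCoeff₂ (p q : ℕ) :
    LaurentPoly (p + q) →ₗ[ℤ] (GenPart p × GenPart q →₀ ℤ) :=
  Finsupp.lcomapDomain (fun x : GenPart p × GenPart q => Fin.append x.1.1 x.2.1) (by
    rintro ⟨u, v⟩ ⟨u', v'⟩ h
    refine Prod.ext (Subtype.ext (funext fun i => ?_)) (Subtype.ext (funext fun i => ?_))
    · simpa using congrFun h (Fin.castAdd q i)
    · simpa using congrFun h (Fin.natAdd p i)) ∘ₗ
    (AddMonoidAlgebra.coeffLinearEquiv ℤ).toLinearMap

lemma dominantCoeff₂_apply {p q : ℕ} (f : LaurentPoly (p + q)) (x : GenPart p × GenPart q) :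
    dominantCoeff₂ p q f x = f.coeff (Fin.append x.1.1 x.2.1) := rfl

/-- The map is the tensor product of the bijections for the two separate sets of variables. -/
lemma bijective_dominantCoeff₂_character₂ (p q : ℕ) :
    Function.Bijective (dominantCoeff₂ p q ∘ₗ character₂ p q) := by
  let e (n : ℕ) : RatRep n ≃ₗ[ℤ] RatRep n :=
    LinearEquiv.ofBijective _ (bijective_dominantCoeff_character n)
  have h : dominantCoeff₂ p q ∘ₗ character₂ p q =
      ((TensorProduct.congr (e p) (e q)).trans
        (finsuppTensorFinsupp' ℤ (GenPart p) (GenPart q))).toLinearMap := by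
    refine TensorProduct.ext' fun f g => Finsupp.ext fun x => ?_
    rw [LinearMap.comp_apply, dominantCoeff₂_apply, character₂_tmul_coeff,
      LinearEquiv.coe_coe, LinearEquiv.trans_apply, TensorProduct.congr_tmul,
      finsuppTensorFinsupp'_apply_apply]
    rfl
  rw [h]
  exact LinearEquiv.bijective _

lemma character₂_injective (p q : ℕ) : Function.Injective (character₂ p q) :=
  Function.Injective.of_comp (f := dominantCoeff₂ p q) (bijective_dominantCoeff₂_character₂ p q).1

/-- Choose `t` with the right coefficients at pairs of dominant exponents. Both sides are symmetric
in each block of variables, and sorting each block carries any exponent to a dominant pair. -/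
lemma exists_character₂_eq {p q : ℕ} (f : RatRep (p + q)) :
    ∃ t, character₂ p q t = character (p + q) f := by
  obtain ⟨t, ht⟩ := (bijective_dominantCoeff₂_character₂ p q).2
    (dominantCoeff₂ p q (character (p + q) f))
  refine ⟨t, AddMonoidAlgebra.coeff_injective (Finsupp.ext fun w => ?_)⟩
  obtain ⟨u, v, rfl⟩ : ∃ u v, w = Fin.append u v := ⟨_, _, (Fin.append_castAdd_natAdd).symm⟩
  obtain ⟨s, hs⟩ := exists_antitone_comp_perm u
  obtain ⟨s', hs'⟩ := exists_antitone_comp_perm v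
  rw [← character₂_coeff_perm t u v s s', ← character_coeff_append_perm f u v s s']
  exact DFunLike.congr_fun ht ((⟨u ∘ s, hs⟩, ⟨v ∘ s', hs'⟩) : GenPart p × GenPart q)

lemma character₂_comp_comul (p q : ℕ) : character₂ p q ∘ₗ comul p q = character (p + q) := by
  refine Classical.epsilon_spec (p := fun D => character₂ p q ∘ₗ D = character (p + q)) ?_
  choose t ht using fun l : GenPart (p + q) => exists_character₂_eq (schurBasis l)
  refine ⟨Finsupp.linearCombination ℤ t, Finsupp.lhom_ext' fun l => LinearMap.ext_ring ?_⟩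
  rw [LinearMap.comp_apply, LinearMap.comp_apply, Finsupp.lsingle_apply,
    Finsupp.linearCombination_single, one_smul, ht]
  rfl

lemma character₂_comul {p q : ℕ} (f : RatRep (p + q)) :
    character₂ p q (comul p q f) = character (p + q) f :=
  LinearMap.congr_fun (character₂_comp_comul p q) f

/-! ### The dual algebra and its involution -/

/-- The linear functional on `R_n` obtained by evaluating monomials. -/
noncomputable def dualOfFun {n : ℕ} (F : (Fin n → ℤ) → ℤ) : DualRep n :=
  evalMonomials F ∘ₗ character n

/-- `character` has a linear left inverse, namely `dominantCoeff` followed by `e.symm`. Composing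
`φ` with it extends `φ` to all Laurent polynomials, where it is given by its values at monomials. -/
lemma dualOfFun_surjective (n : ℕ) :
    Function.Surjective (dualOfFun : ((Fin n → ℤ) → ℤ) → DualRep n) := by
  intro φ
  let e := LinearEquiv.ofBijective _ (bijective_dominantCoeff_character n)
  refine ⟨fun w => φ (e.symm (dominantCoeff n (AddMonoidAlgebra.single w 1))), ?_⟩
  have h : evalMonomials (fun w => φ (e.symm (dominantCoeff n (AddMonoidAlgebra.single w 1)))) =
      φ ∘ₗ e.symm.toLinearMap ∘ₗ dominantCoeff n := by
    refine LinearMap.ext fun f => ?_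
    induction f using laurent_induction with
    | zero => simp
    | add f g hf hg => rw [map_add, map_add, hf, hg]
    | single w a =>
      have h1 : (AddMonoidAlgebra.single w a : LaurentPoly n) =
          a • AddMonoidAlgebra.single w 1 := by
        rw [AddMonoidAlgebra.smul_single, smul_eq_mul, mul_one]
      rw [h1, map_smul, map_smul, evalMonomials_single, one_mul]
      rfl
  refine LinearMap.ext fun f => ?_
  rw [dualOfFun, h]
  exact congrArg φ (e.symm_apply_apply f)

lemma dualMul_dualOfFun {p q : ℕ} (F : (Fin p → ℤ) → ℤ) (G : (Fin q → ℤ) → ℤ) :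
    dualMul (dualOfFun F) (dualOfFun G) = dualOfFun (boxMul F G) := by
  have h : LinearMap.mul' ℤ ℤ ∘ₗ TensorProduct.map (dualOfFun F) (dualOfFun G) =
      evalMonomials (boxMul F G) ∘ₗ character₂ p q := by
    refine TensorProduct.ext' fun f g => ?_
    rw [LinearMap.comp_apply, LinearMap.comp_apply, character₂_tmul, evalMonomials_boxMul,
      TensorProduct.map_tmul, LinearMap.mul'_apply]
    rfl
  rw [dualMul, ← LinearMap.comp_assoc, h, LinearMap.comp_assoc, character₂_comp_comul]
  rfl

lemma dualOfFun_comp_starMap {n : ℕ} (F : (Fin n → ℤ) → ℤ) :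
    dualOfFun F ∘ₗ starMap n = dualOfFun fun w => F (-w) := by
  refine LinearMap.ext fun f => ?_
  have h : (character n (starMap n f)).coeff = (character n f).coeff.equivMapDomain
      (Equiv.neg (Fin n → ℤ)) := Finsupp.ext fun w => character_starMap_coeff f w
  rw [LinearMap.comp_apply, dualOfFun, dualOfFun, LinearMap.comp_apply, LinearMap.comp_apply,
    evalMonomials_apply, h, Finsupp.equivMapDomain_eq_mapDomain,
    Finsupp.sum_mapDomain_index (by simp) (by intros; ring)]
  rfl

lemma dualOfFun_perm {n : ℕ} (F : (Fin n → ℤ) → ℤ) (s : Equiv.Perm (Fin n)) :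
    dualOfFun (fun w => F (w ∘ s)) = dualOfFun F := by
  refine LinearMap.ext fun f => ?_
  have h : (character n f).coeff = (character n f).coeff.equivMapDomain
      (Equiv.arrowCongr s.symm (Equiv.refl ℤ)) :=
    Finsupp.ext fun w => (character_coeff_perm f w s.symm).symm
  conv_rhs => rw [dualOfFun, LinearMap.comp_apply, evalMonomials_apply, h,
    Finsupp.equivMapDomain_eq_mapDomain,
    Finsupp.sum_mapDomain_index (by simp) (by intros; ring)]
  rfl

lemma dualMul_comp_starMap {p q : ℕ} (φ : DualRep p) (ψ : DualRep q) :
    dualMul φ ψ ∘ₗ starMap (p + q) = dualMul (φ ∘ₗ starMap p) (ψ ∘ₗ starMap q) := by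
  obtain ⟨F, rfl⟩ := dualOfFun_surjective p φ
  obtain ⟨G, rfl⟩ := dualOfFun_surjective q ψ
  rw [dualMul_dualOfFun, dualOfFun_comp_starMap, dualOfFun_comp_starMap, dualOfFun_comp_starMap,
    dualMul_dualOfFun]
  rfl

lemma lapply_comp_starMap {n : ℕ} (l : GenPart n) :
    (Finsupp.lapply l : DualRep n) ∘ₗ starMap n = Finsupp.lapply l.star := by
  refine LinearMap.ext fun f => ?_
  have h := Finsupp.mapDomain_apply (GenPart.star_involutive n).injective f l.star
  rw [GenPart.star_star] at h
  exact h

lemma cHat_eq_dualMul {p q : ℕ} (l : GenPart (p + q)) (m : GenPart p) (k : GenPart q) :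
    cHat l m k = dualMul (Finsupp.lapply m) (Finsupp.lapply k) (schurBasis l) := by
  rw [cHat, dualMul, LinearMap.comp_apply, LinearMap.comp_apply]
  induction comul p q (schurBasis l) using TensorProduct.induction_on with
  | zero => simp
  | tmul f g =>
    rw [finsuppTensorFinsupp'_apply_apply, TensorProduct.map_tmul, LinearMap.mul'_apply]
    rfl
  | add x y hx hy => rw [map_add, map_add, map_add, Finsupp.add_apply, hx, hy]

/-- Compares elements in degrees such as `p + q` and `q + p`, equal but not definitionally so, and
allows a relabelling of the variables at the same time. -/
lemma of_dualOfFun_eq {m n : ℕ} (h : m = n) (s : Fin m ≃ Fin n) (F : (Fin m → ℤ) → ℤ)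
    (G : (Fin n → ℤ) → ℤ) (hFG : ∀ w, F (w ∘ s) = G w) :
    DirectSum.of DualRep m (dualOfFun F) = DirectSum.of DualRep n (dualOfFun G) := by
  subst h
  rw [← dualOfFun_perm F s]
  congr 2
  exact funext hFG

lemma of_dualOfFun_mul {p q : ℕ} (F : (Fin p → ℤ) → ℤ) (G : (Fin q → ℤ) → ℤ) :
    DirectSum.of DualRep p (dualOfFun F) * DirectSum.of DualRep q (dualOfFun G) =
      DirectSum.of DualRep (p + q) (dualOfFun (boxMul F G)) := by
  rw [← dualMul_dualOfFun]
  exact DirectSum.of_mul_of _ _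

lemma DualRing.induction {P : DualRing → Prop} (a : DualRing) (zero : P 0)
    (of : ∀ (n : ℕ) (F : (Fin n → ℤ) → ℤ), P (DirectSum.of DualRep n (dualOfFun F)))
    (add : ∀ a b, P a → P b → P (a + b)) : P a := by
  induction a using DirectSum.induction_on with
  | zero => exact zero
  | of n φ =>
    obtain ⟨F, rfl⟩ := dualOfFun_surjective n φ
    exact of n F
  | add a b ha hb => exact add a b ha hb

lemma DualRing.mul_assoc' (a b c : DualRing) : a * b * c = a * (b * c) := by
  induction a using DualRing.induction with
  | zero => simp
  | add a a' h h' => rw [add_mul, add_mul, h, h', add_mul]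
  | of p F =>
  induction b using DualRing.induction with
  | zero => simp
  | add b b' h h' => rw [mul_add, add_mul, h, h', add_mul, mul_add]
  | of q G =>
  induction c using DualRing.induction with
  | zero => simp
  | add c c' h h' => rw [mul_add, h, h', mul_add, mul_add]
  | of r H =>
  rw [of_dualOfFun_mul, of_dualOfFun_mul, of_dualOfFun_mul, of_dualOfFun_mul]
  refine of_dualOfFun_eq (add_assoc p q r) (finCongr (add_assoc p q r)) _ _ fun w => ?_
  rw [boxMul, boxMul, boxMul, boxMul, mul_assoc]
  congr 1
  congr 1
  congr 1
  funext i
  simp only [Function.comp_apply]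
  congr 1
  ext
  simp [add_assoc]

/-- The two products differ by interchanging the blocks of variables, which symmetric characters do
not notice. -/
lemma DualRing.mul_comm' (a b : DualRing) : a * b = b * a := by
  induction a using DualRing.induction with
  | zero => simp
  | add a a' h h' => rw [add_mul, mul_add, h, h']
  | of p F =>
  induction b using DualRing.induction with
  | zero => simp
  | add b b' h h' => rw [mul_add, add_mul, h, h']
  | of q G =>
  rw [of_dualOfFun_mul, of_dualOfFun_mul]
  refine of_dualOfFun_eq (add_comm p q) finAddFlip _ _ fun w => ?_
  rw [boxMul, boxMul, mul_comm]
  simp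

lemma counit_eq : counit = DirectSum.of DualRep 0 (dualOfFun fun _ => 1) := by
  rw [counit]
  congr 1
  refine Finsupp.lhom_ext' fun l => LinearMap.ext_ring ?_
  have h1 : l = GenPart.empty := Subtype.ext (Subsingleton.elim _ _)
  have h2 : (fun _ => 1 : (Fin 0 → ℤ) → ℤ) = Pi.single 0 1 := by
    funext w
    rw [Subsingleton.elim w 0, Pi.single_eq_same]
  have h3 : character 0 (Finsupp.single l 1) = rationalSchur l := character_schurBasis l
  rw [LinearMap.comp_apply, LinearMap.comp_apply, Finsupp.lsingle_apply, dualOfFun,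
    LinearMap.comp_apply, h2, evalMonomials_indicator, h3, GenPart.rationalSchur_coeff, h1,
    Finsupp.lapply_apply, Finsupp.single_eq_same]
  rfl

lemma DualRing.counit_mul (a : DualRing) : counit * a = a := by
  induction a using DualRing.induction with
  | zero => simp
  | add a a' h h' => rw [mul_add, h, h']
  | of p F =>
  rw [counit_eq, of_dualOfFun_mul]
  refine of_dualOfFun_eq (zero_add p) (finCongr (zero_add p)) _ _ fun w => ?_
  rw [boxMul, one_mul]
  congr 1
  funext i
  simp only [Function.comp_apply]
  congr 1
  ext
  simp

lemma omega_of {n : ℕ} (φ : DualRep n) :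
    omega (DirectSum.of DualRep n φ) = DirectSum.of DualRep n (φ ∘ₗ starMap n) :=
  DirectSum.lmap_of _ _ _

lemma starMap_starMap {n : ℕ} (f : RatRep n) : starMap n (starMap n f) = f := by
  rw [starMap, Finsupp.lmapDomain_apply, Finsupp.lmapDomain_apply, ← Finsupp.mapDomain_comp,
    (GenPart.star_involutive n).comp_self, Finsupp.mapDomain_id]

lemma omega_mul (a b : DualRing) : omega (a * b) = omega a * omega b := by
  induction a using DirectSum.induction_on with
  | zero => simp
  | add a a' h h' => rw [add_mul, map_add, h, h', map_add, add_mul]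
  | of p φ =>
  induction b using DirectSum.induction_on with
  | zero => simp
  | add b b' h h' => rw [mul_add, map_add, h, h', map_add, mul_add]
  | of q ψ =>
  rw [DirectSum.of_mul_of, omega_of, omega_of, omega_of, DirectSum.of_mul_of]
  exact congrArg _ (dualMul_comp_starMap φ ψ)

lemma omega_omega (a : DualRing) : omega (omega a) = a := by
  induction a using DirectSum.induction_on with
  | zero => simp
  | add a a' h h' => rw [map_add, map_add, h, h']
  | of p φ =>
  rw [omega_of, omega_of]
  congr 1
  refine LinearMap.ext fun f => ?_
  rw [LinearMap.comp_apply, LinearMap.comp_apply, starMap_starMap]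

lemma omega_sigma {n : ℕ} (l : GenPart n) : omega (sigma l) = sigma l.star := by
  rw [sigma, omega_of, lapply_comp_starMap, sigma]

/-- A structure constant is a value of the product of two dual basis elements at `s_l`, so this is
multiplicativity of `ω` evaluated on the basis. -/
lemma cHat_star {p q : ℕ} (l : GenPart (p + q)) (m : GenPart p) (k : GenPart q) :
    cHat l m k = cHat l.star m.star k.star := by
  have h : schurBasis l.star = starMap (p + q) (schurBasis l) :=
    Finsupp.mapDomain_single.symm
  rw [cHat_eq_dualMul, cHat_eq_dualMul, h, ← LinearMap.comp_apply, dualMul_comp_starMap,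
    lapply_comp_starMap, lapply_comp_starMap, GenPart.star_star, GenPart.star_star]

theorem mainTheorem12 :
    -- the rational Schur polynomials are linearly independent, and `Δ` is the comultiplication
    -- given by splitting the set of variables, and the only such map
    (∀ n : ℕ, LinearIndependent ℤ (rationalSchur : GenPart n → LaurentPoly n)) ∧
    (∀ (p q : ℕ) (D : RatRep (p + q) →ₗ[ℤ] RatRep p ⊗[ℤ] RatRep q),
      (∀ f, character₂ p q (D f) = character (p + q) f) ↔ D = comul p q) ∧
    -- the graded dual is a commutative algebra with unit `ε`
    (∀ a b c : DualRing, a * b * c = a * (b * c)) ∧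
    (∀ a b : DualRing, a * b = b * a) ∧
    (∀ a : DualRing, counit * a = a) ∧
    -- `ω` is given by `σ_l ↦ σ_{l*}` (also on infinite combinations), and fixes `ε`
    (∀ (n : ℕ) (l : GenPart n), omega (sigma l) = sigma l.star) ∧
    (∀ (n : ℕ) (φ : DualRing) (l : GenPart n),
      omega φ n (schurBasis l.star) = φ n (schurBasis l)) ∧
    omega counit = counit ∧
    -- `ω` is an involution of the algebra
    (∀ a b : DualRing, omega (a * b) = omega a * omega b) ∧
    (∀ a : DualRing, omega (omega a) = a) ∧
    -- equivalently, the structure constants are symmetric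
    (∀ (p q : ℕ) (l : GenPart (p + q)) (m : GenPart p) (k : GenPart q),
      cHat l m k = cHat l.star m.star k.star) := by
  refine ⟨character_injective, fun p q D => ⟨fun h => ?_, ?_⟩, DualRing.mul_assoc',
    DualRing.mul_comm', DualRing.counit_mul, fun _ => omega_sigma, fun n φ l => ?_, ?_, omega_mul,
    omega_omega, fun _ _ => cHat_star⟩
  · exact LinearMap.ext fun f =>
      character₂_injective p q ((h f).trans (character₂_comul f).symm)
  · rintro rfl
    exact character₂_comul
  · have h : starMap n (schurBasis l.star) = schurBasis l := by
      rw [schurBasis, starMap, Finsupp.lmapDomain_apply, Finsupp.mapDomain_single,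
        GenPart.star_star, schurBasis]
    exact congrArg (φ n) h
  · have h : GenPart.empty.star = GenPart.empty := Subtype.ext (Subsingleton.elim _ _)
    have h' := omega_sigma GenPart.empty
    rw [h] at h'
    exact h'
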